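/- Let $k$ be a field. For an ideal $I$ of an Artinian local ring $A$ let $G(I)=\bigoplus_{n\ge 0} I^n/I^{n+1}$, with Hilbert function $n\mapsto \ell_{A/I}(I^n/I^{n+1})$. Call a numerical function $H$ an $I$-Gorenstein sequence (over $k$) if it is the Hilbert function of $G(I)$ for some ideal $I$ in some Artinian Gorenstein (AG) local ring $A=k[[x,y]]/J$. Write $H=(h_0,\dots,h_u)$ if $h_u\ne 0$ and $H(n)=0$ for $n>u$; $u$ is the end degree. $H$ is $2$-admissible if for every $n\ge 0$, writing $H(n)=(n+1)q+r$ with $0\le r\le n$ and $r=\binom{\kappa_n}{n}+\dots+\binom{\kappa_1}{1}$ with $\kappa_n>\dots>\kappa_1\ge 0$ (the $n$-th Macaulay representation), one has $H(n+1)\le (n+2)q+\binom{\kappa_n+1}{n+1}+\dots+\binom{\kappa_1+1}{2}$. Let $F$ run over the following elements of the divided power ring $k_{DP}[X,Y]$ ($X^aY^b$ denotes the divided power monomial $X^{[a]}Y^{[b]}$). Each sequence $H$ is listed with a form $F$ and with rows $H(0)$; $H(1)$; $H(2)$; … (missing entries and rows are zero): - $(2,1)$: $X+Y^2$; $H(0)=(1,1)$,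 $H(1)=(1)$. - $(2,2)$: $XY$; $H(0)=(2,2)$. - $(2,1,1)$: $X^2+Y^2$; $H(0)=(1,1,1)$, $H(2)=(1)$. - $(2,2,1)$: $X^2+Y^3$; $H(0)=(1,1,1)$, $H(1)=(1,1)$. - $(2,2,2)$: $X^2Y$; $H(0)=(2,2,2)$. - $(2,3,1)$: $XY^2$; $H(0)=(1,2,1)$, $H(1)=(1,1)$. - $(2,3,2)$: $X^2Y+Y^4$; $H(0)=(2,3,2)$. - $(2,4,2)$: $XY^3$; $H(0)=(2,4,2)$. - $(2,1,1,1)$: $X^3+Y^2$; $H(0)=(1,1,1,1)$, $H(3)=(1)$. - $(2,2,1,1)$: $X^3+Y^3$; $H(0)=(1,1,1,1)$, $H(2)=(1,1)$. - $(2,2,2,1)$: $X+Y^6$; $H(0)=(1,1,1,1)$, $H(1)=(1,1,1)$. - $(2,2,2,2)$: $X^3Y$; $H(0)=(2,2,2,2)$. - $(2,3,1,1)$: $X^3+Y^4$; $H(0)=(1,1,1,1)$, $H(1)=(0,1,0)$, $H(2)=(1,1)$. - $(2,3,2,1)$: $X^2+Y^6$; $H(0)=(1,1,1,1)$, $H(1)=(1,2,1)$.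 - $(2,3,2,2)$: $X^2+Y^7$; $H(0)=(2,2,2,2)$, $H(1)=(0,1,0)$. - $(2,3,3,1)$: $X^2Y^2$; $H(0)=(1,2,2,1)$, $H(1)=(1,1,1)$. - $(2,3,3,2)$: $X^3+Y^7$; $H(0)=(2,3,3,2)$. - $(2,4,2,1)$: $X^2Y+Y^6$; $H(0)=(1,1,1,1)$, $H(1)=(1,3,1)$. - $(2,4,2,2)$: $X^2Y+Y^7$; $H(0)=(2,2,2,2)$, $H(1)=(0,2,0)$. - $(2,4,3,1)$: $XY^4$; $H(0)=(1,2,2,1)$, $H(1)=(1,2,1)$. - $(2,4,3,2)$: $Y^7+X^2Y^2$; $H(0)=(2,3,3,2)$, $H(1)=(0,1,0)$. - $(2,4,4,2)$: $XY^5$; $H(0)=(2,4,4,2)$. Then: (a) The $2$-admissible sequences $(h_0,\dots,h_u)$ with $h_0=2$, $1\le u\le 3$ and $h_u\le 2$ are exactly the $22$ sequences above, the seven sequences $(2,4,1)$, $(2,2,3,1)$, $(2,2,3,2)$, $(2,3,4,1)$, $(2,3,4,2)$, $(2,4,1,1)$, $(2,4,4,1)$, and the four sequences $(2,4,5,1)$,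 $(2,4,5,2)$, $(2,4,6,1)$, $(2,4,6,2)$. (b) A $2$-admissible sequence with $h_0=2$ and $1\le u\le 3$ is $I$-Gorenstein if and only if it is one of the $22$ sequences above. (c) For each of the $22$ rows, with $k[[x,y]]$ acting on $k_{DP}[X,Y]$ by contraction, $A_F=k[[x,y]]/\operatorname{ann}(F)$ is an AG local ring, the ideal $I=(x,y^2)A_F$ satisfies $I^u\ne0$ and $I^{u+1}=0$, the Hilbert function of $G(I)$ is the listed $H$, and its symmetric decomposition is the listed one: $H(a)$ is the Hilbert function of $C(a)/C(a+1)$, where $C(a)_i$ is the image of $(0:I^{u+1-a-i})\cap I^i$ in $I^i/I^{i+1}$ (with $I^m=A_F$ for $m\le 0$). (d) None of the seven and four further sequences in (a) is $I$-Gorenstein. -/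

import Mathlib

/-! ### Hilbert functions of associated graded rings of ideals -/

/-- An Artinian Gorenstein local ring: an Artinian local ring whose socle `(0 : 𝔪)` has length
one (equivalently, is a one-dimensional vector space over the residue field). -/
def IsArtinianGorenstein (A : Type*) [CommRing A] : Prop :=
  IsArtinianRing A ∧
    ∃ _ : IsLocalRing A, Module.length A ↥(IsLocalRing.maximalIdeal A).annihilator = 1

section GradedPieces

variable {A : Type*} [CommRing A]

/-- The degree `n` component `Iⁿ / Iⁿ⁺¹` of the associated graded ring `G(I) = ⨁ Iⁿ / Iⁿ⁺¹`,
with `Iⁿ⁺¹` written as `I • Iⁿ`, so that the component is a module over `G(I)₀ = A / I`. -/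
abbrev GradedPiece (I : Ideal A) (n : ℕ) : Type _ :=
  ↥(I ^ n) ⧸ (I • ⊤ : Submodule A ↥(I ^ n))

/-- The Hilbert function of `G(I)`: the length of `Iⁿ / Iⁿ⁺¹` over `G(I)₀ = A / I`. -/
noncomputable def hilbertG (I : Ideal A) (n : ℕ) : ℕ∞ :=
  Module.length (A ⧸ I) (GradedPiece I n)

/-- `C(a)ᵢ`, the image of `(0 : I ^ (u + 1 - a - i)) ∩ Iⁱ` in `Iⁱ / Iⁱ⁺¹`.  Nonpositive powers of
`I` are `A`, as usual; this agrees with the truncated subtraction in the exponent. -/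
def gradedC (I : Ideal A) (u a i : ℕ) : Submodule A (GradedPiece I i) :=
  ((I ^ (u + 1 - a - i)).annihilator.submoduleOf (I ^ i)).map
    (Submodule.mkQ (I • ⊤ : Submodule A ↥(I ^ i)))

/-- `H(a)ᵢ`, the length of the degree `i` component of `Q(a) = C(a) / C(a + 1)`, where `u` is the
end degree of `I`. -/
noncomputable def symmDecomp (I : Ideal A) (u a i : ℕ) : ℕ∞ :=
  Module.length A
    (↥(gradedC I u a i) ⧸ (gradedC I u (a + 1) i).submoduleOf (gradedC I u a i))

end GradedPieces

/-! ### Numerical functions -/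

/-- The numerical function `(h₀, h₁, …, hᵤ, 0, 0, …)` given by a finite list. -/
def seqOfList (l : List ℕ) : ℕ → ℕ := fun n => l.getD n 0

/-- `u` is the end degree of the numerical function `H`. -/
def HasEndDegree (H : ℕ → ℕ) (u : ℕ) : Prop :=
  H u ≠ 0 ∧ ∀ n, u < n → H n = 0

/-- `r = C(κ n, n) + ⋯ + C(κ 1, 1)` with `κ n > ⋯ > κ 1 ≥ 0` is the `n`-th Macaulay
representation of `r`. -/
def IsMacaulayRep (n r : ℕ) (κ : ℕ → ℕ) : Prop :=
  StrictMonoOn κ (Set.Icc 1 n) ∧ r = ∑ i ∈ Finset.Icc 1 n, (κ i).choose i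

/-- `b`-admissible numerical functions (`b ≥ 1`).  Write
`H n = C(n + b - 1, b - 1) * q + r` by division with remainder, and let `κ` be the `n`-th Macaulay
representation of `r`; then `H (n + 1) ≤ C(n + b, b - 1) * q + ∑ C(κ i + 1, i + 1)`. -/
def IsAdmissible (b : ℕ) (H : ℕ → ℕ) : Prop :=
  ∀ n : ℕ, ∃ κ : ℕ → ℕ,
    IsMacaulayRep n (H n % (n + b - 1).choose (b - 1)) κ ∧
    H (n + 1) ≤ (n + b).choose (b - 1) * (H n / (n + b - 1).choose (b - 1)) +
      ∑ i ∈ Finset.Icc 1 n, (κ i + 1).choose (i + 1)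

/-- `H` is the Hilbert function of `G(I)` for an ideal `I` of some Artinian Gorenstein quotient
`A = k⟦x, y⟧ / J`. -/
def IsIGorenstein (k : Type*) [Field k] (H : ℕ → ℕ) : Prop :=
  ∃ J : Ideal (MvPowerSeries (Fin 2) k),
    IsArtinianGorenstein (MvPowerSeries (Fin 2) k ⧸ J) ∧
    ∃ I : Ideal (MvPowerSeries (Fin 2) k ⧸ J), ∀ n, hilbertG I n = (H n : ℕ∞)

/-! ### Divided powers, contraction and apolar algebras -/

/-- The divided power ring `k_DP[X, Y]`, as the free module on the divided power monomials
`X^[a] Y^[b]`.  Only its module structure over `k⟦x, y⟧` is needed. -/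
def DPModule (k : Type*) [Field k] : Type _ := (Fin 2 →₀ ℕ) →₀ k

section Contraction

variable {k : Type*} [Field k]

noncomputable instance : AddCommGroup (DPModule k) :=
  inferInstanceAs (AddCommGroup ((Fin 2 →₀ ℕ) →₀ k))

/-- The divided power monomial with exponent `β`, with coefficient `c`. -/
noncomputable def dpMonomial (β : Fin 2 →₀ ℕ) : k →+ DPModule k :=
  Finsupp.singleAddHom β

/-- `g ∘ (c Z^[β]) = ∑_{α + γ = β} g_α c Z^[γ]`; that is, `z^α` sends `Z^[β]` to `Z^[β - α]` if
`α ≤ β` and to `0` otherwise. -/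
noncomputable def contractMonomial (g : MvPowerSeries (Fin 2) k) (β : Fin 2 →₀ ℕ) :
    k →+ DPModule k :=
  ∑ p ∈ Finset.HasAntidiagonal.antidiagonal β,
    (dpMonomial p.2).comp (AddMonoidHom.mulLeft (MvPowerSeries.coeff p.1 g))

/-- The contraction action of a power series on the divided power ring. -/
noncomputable def contract (g : MvPowerSeries (Fin 2) k) : DPModule k →+ DPModule k :=
  Finsupp.liftAddHom (contractMonomial g)

theorem contract_monomial (g : MvPowerSeries (Fin 2) k) (β : Fin 2 →₀ ℕ) (c : k) :
    contract g (dpMonomial β c) = ∑ p ∈ Finset.HasAntidiagonal.antidiagonal β,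
      dpMonomial p.2 (MvPowerSeries.coeff p.1 g * c) := by
  have h : contract g (dpMonomial β c) = contractMonomial g β c :=
    Finsupp.liftAddHom_apply_single (contractMonomial g) β c
  rw [h, contractMonomial, AddMonoidHom.finsetSum_apply]
  rfl

theorem dpHom_ext {f f' : DPModule k →+ DPModule k}
    (h : ∀ β c, f (dpMonomial β c) = f' (dpMonomial β c)) : f = f' :=
  Finsupp.addHom_ext h

theorem contract_one : contract (1 : MvPowerSeries (Fin 2) k) = AddMonoidHom.id _ := by
  classical
  refine dpHom_ext fun β c => ?_
  rw [contract_monomial, Finset.sum_eq_single (0, β)]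
  · simp
  · rintro ⟨α, γ⟩ hp hne
    have hα : α ≠ 0 := by
      rintro rfl
      apply hne
      simpa using hp
    simp [MvPowerSeries.coeff_one, hα]
  · intro h
    exact absurd (by simp) h

theorem contract_zero : contract (0 : MvPowerSeries (Fin 2) k) = 0 := by
  refine dpHom_ext fun β c => ?_
  simp [contract_monomial]

theorem contract_add (g h : MvPowerSeries (Fin 2) k) :
    contract (g + h) = contract g + contract h := by
  refine dpHom_ext fun β c => ?_
  simp [contract_monomial, add_mul, Finset.sum_add_distrib]

theorem contract_mul (g h : MvPowerSeries (Fin 2) k) :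
    contract (g * h) = (contract g).comp (contract h) := by
  classical
  refine dpHom_ext fun β c => ?_
  rw [mul_comm g h]
  simp only [contract_monomial, AddMonoidHom.comp_apply, map_sum, MvPowerSeries.coeff_mul,
    Finset.sum_mul]
  rw [Finset.sum_sigma', Finset.sum_sigma']
  refine Finset.sum_nbij' (fun s => ⟨(s.2.1, s.2.2 + s.1.2), (s.2.2, s.1.2)⟩)
    (fun s => ⟨(s.1.1 + s.2.1, s.2.2), (s.1.1, s.2.1)⟩) ?_ ?_ ?_ ?_ ?_
  · rintro ⟨⟨a, b⟩, ⟨c, d⟩⟩ hs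
    simp only [Finset.mem_sigma, Finset.HasAntidiagonal.mem_antidiagonal] at hs ⊢
    obtain ⟨rfl, rfl⟩ := hs
    simp [add_assoc]
  · rintro ⟨⟨a, b⟩, ⟨c, d⟩⟩ hs
    simp only [Finset.mem_sigma, Finset.HasAntidiagonal.mem_antidiagonal] at hs ⊢
    obtain ⟨rfl, rfl⟩ := hs
    simp [add_assoc]
  · rintro ⟨⟨a, b⟩, ⟨c, d⟩⟩ hs
    simp only [Finset.mem_sigma, Finset.HasAntidiagonal.mem_antidiagonal] at hs
    obtain ⟨rfl, rfl⟩ := hs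
    rfl
  · rintro ⟨⟨a, b⟩, ⟨c, d⟩⟩ hs
    simp only [Finset.mem_sigma, Finset.HasAntidiagonal.mem_antidiagonal] at hs
    obtain ⟨rfl, rfl⟩ := hs
    rfl
  · rintro ⟨⟨a, b⟩, ⟨p, q⟩⟩ hs
    congr 1
    ring

/-- The divided power ring as a module over `k⟦x, y⟧` by contraction. -/
noncomputable instance : Module (MvPowerSeries (Fin 2) k) (DPModule k) where
  smul g F := contract g F
  one_smul F := DFunLike.congr_fun contract_one F
  mul_smul g h F := DFunLike.congr_fun (contract_mul g h) F
  smul_zero g := map_zero (contract g)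
  smul_add g F G := map_add (contract g) F G
  add_smul g h F := DFunLike.congr_fun (contract_add g h) F
  zero_smul F := DFunLike.congr_fun contract_zero F

/-- The apolar algebra `A_F = k⟦x, y⟧ / ann(F)`. -/
abbrev ApolarAlgebra (F : DPModule k) : Type _ :=
  MvPowerSeries (Fin 2) k ⧸ Ideal.torsionOf (MvPowerSeries (Fin 2) k) (DPModule k) F

/-- The ideal `(x, y²)` of the apolar algebra `A_F`. -/
noncomputable def idealXYsq (F : DPModule k) : Ideal (ApolarAlgebra F) :=
  Ideal.span {Ideal.Quotient.mk _ (MvPowerSeries.X 0), Ideal.Quotient.mk _ (MvPowerSeries.X 1 ^ 2)}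

end Contraction

/-- The sum of the divided power monomials `X^[a] Y^[b]` over the pairs `(a, b)` of a list. -/
noncomputable def dpForm (k : Type*) [Field k] (l : List (ℕ × ℕ)) : DPModule k :=
  (l.map fun e => dpMonomial (Finsupp.single 0 e.1 + Finsupp.single 1 e.2) (1 : k)).sum

/-! ### The tables -/

/-- A realized sequence: the sequence `(h₀, …, hᵤ)`, the exponents `(a, b)` of the monomials
`X^[a] Y^[b]` whose sum is `F`, and the rows `H(0), H(1), …` of the symmetric decomposition
(missing entries and rows are zero). -/
structure RealizedSequence where
  seq : List ℕ
  form : List (ℕ × ℕ)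
  decomp : List (List ℕ)

/-- The realized sequences, with forms and symmetric decompositions. -/
def realizedTable : List RealizedSequence :=
  [⟨[2, 1], [(1, 0), (0, 2)], [[1, 1], [1]]⟩,
   ⟨[2, 2], [(1, 1)], [[2, 2]]⟩,
   ⟨[2, 1, 1], [(2, 0), (0, 2)], [[1, 1, 1], [], [1]]⟩,
   ⟨[2, 2, 1], [(2, 0), (0, 3)], [[1, 1, 1], [1, 1]]⟩,
   ⟨[2, 2, 2], [(2, 1)], [[2, 2, 2]]⟩,
   ⟨[2, 3, 1], [(1, 2)], [[1, 2, 1], [1, 1]]⟩,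
   ⟨[2, 3, 2], [(2, 1), (0, 4)], [[2, 3, 2]]⟩,
   ⟨[2, 4, 2], [(1, 3)], [[2, 4, 2]]⟩,
   ⟨[2, 1, 1, 1], [(3, 0), (0, 2)], [[1, 1, 1, 1], [], [], [1]]⟩,
   ⟨[2, 2, 1, 1], [(3, 0), (0, 3)], [[1, 1, 1, 1], [], [1, 1]]⟩,
   ⟨[2, 2, 2, 1], [(1, 0), (0, 6)], [[1, 1, 1, 1], [1, 1, 1]]⟩,
   ⟨[2, 2, 2, 2], [(3, 1)], [[2, 2, 2, 2]]⟩,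
   ⟨[2, 3, 1, 1], [(3, 0), (0, 4)], [[1, 1, 1, 1], [0, 1, 0], [1, 1]]⟩,
   ⟨[2, 3, 2, 1], [(2, 0), (0, 6)], [[1, 1, 1, 1], [1, 2, 1]]⟩,
   ⟨[2, 3, 2, 2], [(2, 0), (0, 7)], [[2, 2, 2, 2], [0, 1, 0]]⟩,
   ⟨[2, 3, 3, 1], [(2, 2)], [[1, 2, 2, 1], [1, 1, 1]]⟩,
   ⟨[2, 3, 3, 2], [(3, 0), (0, 7)], [[2, 3, 3, 2]]⟩,
   ⟨[2, 4, 2, 1], [(2, 1), (0, 6)], [[1, 1, 1, 1], [1, 3, 1]]⟩,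
   ⟨[2, 4, 2, 2], [(2, 1), (0, 7)], [[2, 2, 2, 2], [0, 2, 0]]⟩,
   ⟨[2, 4, 3, 1], [(1, 4)], [[1, 2, 2, 1], [1, 2, 1]]⟩,
   ⟨[2, 4, 3, 2], [(0, 7), (2, 2)], [[2, 3, 3, 2], [0, 1, 0]]⟩,
   ⟨[2, 4, 4, 2], [(1, 5)], [[2, 4, 4, 2]]⟩]

/-- The realized sequences. -/
def realizedSequences : List (List ℕ) :=
  [[2, 1], [2, 2], [2, 1, 1], [2, 2, 1], [2, 2, 2], [2, 3, 1], [2, 3, 2], [2, 4, 2],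
   [2, 1, 1, 1], [2, 2, 1, 1], [2, 2, 2, 1], [2, 2, 2, 2], [2, 3, 1, 1], [2, 3, 2, 1],
   [2, 3, 2, 2], [2, 3, 3, 1], [2, 3, 3, 2], [2, 4, 2, 1], [2, 4, 2, 2], [2, 4, 3, 1],
   [2, 4, 3, 2], [2, 4, 4, 2]]

theorem realizedTable_map_seq : realizedTable.map RealizedSequence.seq = realizedSequences := rfl

/-- The tabulated admissible sequences that are not realized. -/
def excludedSequences : List (List ℕ) :=
  [[2, 4, 1], [2, 2, 3, 1], [2, 2, 3, 2], [2, 3, 4, 1], [2, 3, 4, 2], [2, 4, 1, 1], [2, 4, 4, 1]]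

/-- The four further admissible sequences `(h₀, …, hᵤ)` with `h₀ = 2`, `1 ≤ u ≤ 3` and `hᵤ ≤ 2`;
they are not realized either. -/
def furtherExcludedSequences : List (List ℕ) :=
  [[2, 4, 5, 1], [2, 4, 5, 2], [2, 4, 6, 1], [2, 4, 6, 2]]

/-! Both directions rest on one inequality: in an Artinian local ring with socle of length at most
one, ℓ(0 : K) ≤ ℓ(A/K) for every ideal K (`idealLength_annihilator_add_le`).

Necessity. The condition h₀ = 2 says that I has colength two. As m has two generators, they can be
chosen so that m = (x, y) and I = (x, y²) (`exists_eq_span_sup_span_sq`). Two kinds of restrictions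
follow. Relations between generators, without the Gorenstein hypothesis, show that h₁ ≤ 2 forces h₂
≤ 2 and h₁ ≤ 3 forces h₂ ≤ 3: a small I/I² makes y times some generator of I fall into I², which
leaves few generators for I²/I³. Duality gives the rest, since ideals that kill I have length at
most two: for example Iᵘ kills I, so hᵤ ≤ 2, and if I⁴ = 0 then I² kills itself, so 2ℓ(I²) ≤ ℓ(A).
The resulting `ColengthTwoConditions` rule out all eleven further sequences.

Realization. In A_F the functional sending g to the constant term of g ∘ F gives a nondegenerate
pairing, for which a suitable set of monomials is its own dual basis up to a permutation. Each
monomial visibly lies in some power of I = (x, y²) and kills some other power. These containments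
bound ℓ(Iⁿ) and ℓ(0 : Iⁿ) from below; when the bounds add up to ℓ(A), duality makes them equalities
(`mem_pow_iff_and_mem_annihilator_pow_iff`), and the Hilbert function and its symmetric
decomposition become counts of exponents. No field enters these counts, so one finite computation
covers every k.

Admissibility. For b = 2 the remainder in degree n is at most n, and the Macaulay growth of such an
r is r itself, so the list is a finite enumeration. -/

/-! ### Lengths of ideals in Artinian rings -/

section IdealLength

variable {A : Type*} [CommRing A]

/-- The length of an ideal as a natural number (meaningful over Artinian rings). -/
noncomputable def idealLength (K : Ideal A) : ℕ := (Module.length A K).toNat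

/-- `Iⁿ⁺¹`, as a submodule of `Iⁿ`. -/
theorem smul_top_eq_submoduleOf (I : Ideal A) (n : ℕ) :
    (I • ⊤ : Submodule A ↥(I ^ n)) = (I ^ (n + 1)).submoduleOf (I ^ n) := by
  apply Submodule.map_injective_of_injective (Submodule.injective_subtype (I ^ n))
  rw [Submodule.map_smul'', Submodule.map_top, Submodule.range_subtype, Submodule.submoduleOf,
    Submodule.map_comap_subtype, inf_eq_right.2 (Ideal.pow_le_pow_right n.le_succ), pow_succ',
    smul_eq_mul]

theorem hilbertG_eq_length (I : Ideal A) (n : ℕ) :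
    hilbertG I n = Module.length A (GradedPiece I n) :=
  (Module.length_eq_of_surjective Ideal.Quotient.mk_surjective).symm

theorem length_quotient_add {M : Type*} [AddCommGroup M] [Module A M] (P Q : Submodule A M)
    (h : P ≤ Q) :
    Module.length A (Q ⧸ P.submoduleOf Q) + Module.length A P = Module.length A Q := by
  rw [← (Submodule.submoduleOfEquivOfLe h).length_eq, add_comm]
  exact (Module.length_eq_add_of_exact (P.submoduleOf Q).subtype (P.submoduleOf Q).mkQ
    (Submodule.injective_subtype _) (Submodule.mkQ_surjective _)
    (LinearMap.exact_subtype_mkQ _)).symm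

theorem hilbertG_add_length (I : Ideal A) (n : ℕ) :
    hilbertG I n + Module.length A ↥(I ^ (n + 1)) = Module.length A ↥(I ^ n) := by
  rw [hilbertG_eq_length, ← length_quotient_add (I ^ (n + 1)) (I ^ n)
    (Ideal.pow_le_pow_right n.le_succ), ← smul_top_eq_submoduleOf]

theorem length_map_add {M N : Type*} [AddCommGroup M] [Module A M] [AddCommGroup N] [Module A N]
    (f : M →ₗ[A] N) (P : Submodule A M) :
    Module.length A (P.map f) + Module.length A ↥(P ⊓ LinearMap.ker f) = Module.length A P := by
  have e : (LinearMap.ker f).submoduleOf P = LinearMap.ker (f.domRestrict P) := by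
    ext; simp [Submodule.submoduleOf, Submodule.mem_comap]
  have := Module.length_eq_add_of_exact (LinearMap.ker (f.domRestrict P)).subtype
    (f.domRestrict P).rangeRestrict (Submodule.injective_subtype _)
    (LinearMap.surjective_rangeRestrict _) (by
      rw [LinearMap.exact_iff, LinearMap.ker_rangeRestrict, Submodule.range_subtype])
  rw [this, add_comm]
  congr 1
  · rw [← e, Submodule.submoduleOf, LinearEquiv.length_eq
      (Submodule.equivMapOfInjective P.subtype (Submodule.injective_subtype P) _),
      Submodule.map_comap_subtype]
  · rw [LinearMap.range_domRestrict]

/-- The kernel of the map from (0 : I^(u+1-a-i)) ∩ Iⁱ to Iⁱ/Iⁱ⁺¹ is the intersection with Iⁱ⁺¹. This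
reduces the symmetric decomposition to lengths of ideals of A. -/
theorem length_gradedC_add (I : Ideal A) (u a i : ℕ) :
    Module.length A (gradedC I u a i) +
        Module.length A ↥((I ^ (u + 1 - a - i)).annihilator ⊓ I ^ (i + 1)) =
      Module.length A ↥((I ^ (u + 1 - a - i)).annihilator ⊓ I ^ i) := by
  have key := length_map_add (Submodule.mkQ (I • ⊤ : Submodule A ↥(I ^ i)))
    ((I ^ (u + 1 - a - i)).annihilator.submoduleOf (I ^ i))
  have hlen : ∀ P : Ideal A, Module.length A (P.submoduleOf (I ^ i)) =
      Module.length A ↥(P ⊓ I ^ i) := fun P => by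
    rw [Submodule.submoduleOf, LinearEquiv.length_eq
      (Submodule.equivMapOfInjective (I ^ i).subtype (Submodule.injective_subtype _) _),
      Submodule.map_comap_subtype, inf_comm]
  have hinf : Module.length A ↥((I ^ (u + 1 - a - i)).annihilator.submoduleOf (I ^ i) ⊓
      (I • ⊤ : Submodule A ↥(I ^ i))) =
      Module.length A ↥((I ^ (u + 1 - a - i)).annihilator ⊓ I ^ (i + 1)) := by
    rw [smul_top_eq_submoduleOf]
    refine (hlen ((I ^ (u + 1 - a - i)).annihilator ⊓ I ^ (i + 1))).trans ?_
    rw [inf_assoc, inf_eq_left.2 (Ideal.pow_le_pow_right i.le_succ : I ^ (i + 1) ≤ I ^ i)]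
  rw [Submodule.ker_mkQ, hinf, hlen] at key
  exact key

theorem gradedC_anti (I : Ideal A) (u a i : ℕ) : gradedC I u (a + 1) i ≤ gradedC I u a i := by
  refine Submodule.map_mono (Submodule.comap_mono (Submodule.annihilator_mono ?_))
  exact Ideal.pow_le_pow_right (by omega)

theorem symmDecomp_add_length (I : Ideal A) (u a i : ℕ) :
    symmDecomp I u a i + Module.length A (gradedC I u (a + 1) i) =
      Module.length A (gradedC I u a i) :=
  length_quotient_add _ _ (gradedC_anti I u a i)

theorem idealLength_bot : idealLength (⊥ : Ideal A) = 0 := by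
  simp [idealLength]

variable [IsArtinianRing A]

theorem coe_idealLength (K : Ideal A) : (idealLength K : ℕ∞) = Module.length A K :=
  ENat.natCast_toNat Module.length_ne_top

theorem idealLength_mono {K L : Ideal A} (h : K ≤ L) : idealLength K ≤ idealLength L := by
  have := Module.length_le_of_injective (Submodule.inclusion h) (Submodule.inclusion_injective h)
  rw [← coe_idealLength, ← coe_idealLength] at this
  exact_mod_cast this

theorem idealLength_strictMono {K L : Ideal A} (h : K < L) : idealLength K < idealLength L := by
  have := Submodule.height_strictMono h
  rw [← Module.length_submodule, ← Module.length_submodule, ← coe_idealLength,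
    ← coe_idealLength] at this
  exact_mod_cast this

theorem eq_of_le_of_idealLength_le {K L : Ideal A} (h : K ≤ L)
    (hl : idealLength L ≤ idealLength K) : K = L := by
  by_contra hne
  exact absurd (idealLength_strictMono (lt_of_le_of_ne h hne)) (by omega)

theorem idealLength_pow_eq (I : Ideal A) {H : ℕ → ℕ} (h : ∀ n, hilbertG I n = (H n : ℕ∞)) (n : ℕ) :
    idealLength (I ^ n) = H n + idealLength (I ^ (n + 1)) := by
  have := hilbertG_add_length I n
  rw [h, ← coe_idealLength, ← coe_idealLength] at this
  exact_mod_cast this.symm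

theorem idealLength_map_add {M : Type*} [AddCommGroup M] [Module A M] (f : A →ₗ[A] M)
    (L : Ideal A) :
    Module.length A (Submodule.map f L) + idealLength (L ⊓ LinearMap.ker f) = idealLength L := by
  rw [coe_idealLength, coe_idealLength]
  exact length_map_add f L

variable [IsLocalRing A]

open IsLocalRing

/-- Adding a generator killed by the maximal ideal modulo `K` raises the length by at most one. -/
theorem idealLength_sup_span_singleton_le {K : Ideal A} {z : A}
    (h : maximalIdeal A * Ideal.span {z} ≤ K) :
    idealLength (K ⊔ Ideal.span {z}) ≤ idealLength K + 1 := by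
  have h1 := idealLength_map_add (Submodule.mkQ K) (K ⊔ Ideal.span {z})
  rw [Submodule.ker_mkQ, inf_eq_right.2 (le_sup_left : K ≤ _)] at h1
  have h2 : Module.length A (Submodule.map (Submodule.mkQ K) (K ⊔ Ideal.span {z})) ≤ 1 := by
    have e : Submodule.map (Submodule.mkQ K) (K ⊔ Ideal.span {z}) =
        LinearMap.range (LinearMap.toSpanSingleton A (A ⧸ K) (Submodule.mkQ K z)) := by
      rw [Submodule.map_sup, Submodule.mkQ_map_self, bot_sup_eq, LinearMap.range_toSpanSingleton,
        Ideal.span, Submodule.map_span, Set.image_singleton]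
    rw [e, ← (LinearMap.quotKerEquivRange _).length_eq]
    have hle : maximalIdeal A ≤
        LinearMap.ker (LinearMap.toSpanSingleton A (A ⧸ K) (Submodule.mkQ K z)) := by
      intro a ha
      rw [LinearMap.mem_ker, LinearMap.toSpanSingleton_apply, ← map_smul, Submodule.mkQ_apply,
        Submodule.Quotient.mk_eq_zero]
      exact h (Ideal.mul_mem_mul ha (Ideal.mem_span_singleton_self z))
    refine (Module.length_le_of_surjective (Submodule.factor hle)
      (Submodule.factor_surjective hle)).trans (le_of_eq ?_)
    have : IsSimpleModule A (A ⧸ maximalIdeal A) :=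
      isSimpleModule_iff_isCoatom.2 (maximalIdeal.isMaximal A).out
    exact Module.length_eq_one A _
  have h3 : (idealLength (K ⊔ Ideal.span {z}) : ℕ∞) ≤ 1 + idealLength K := by
    rw [← h1]; exact add_le_add_left h2 _
  have h4 : idealLength (K ⊔ Ideal.span {z}) ≤ 1 + idealLength K := by exact_mod_cast h3
  omega

theorem exists_pow_maximalIdeal_eq_bot : ∃ n, maximalIdeal A ^ n = ⊥ := by
  rw [← jacobson_eq_maximalIdeal (⊥ : Ideal A) bot_ne_top]
  exact IsArtinianRing.isNilpotent_jacobson_bot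

/-- The socle of A/K is nonzero: z is taken from the last power of m not contained in K. -/
theorem exists_notMem_maximalIdeal_mul_le {K : Ideal A} (h : K ≠ ⊤) :
    ∃ z, z ∉ K ∧ maximalIdeal A * Ideal.span {z} ≤ K := by
  classical
  have hex : ∃ n, maximalIdeal A ^ n ≤ K :=
    (exists_pow_maximalIdeal_eq_bot (A := A)).imp fun n hn => hn.trans_le bot_le
  obtain ⟨n, hn⟩ : ∃ n, Nat.find hex = n + 1 := by
    refine Nat.exists_eq_succ_of_ne_zero fun h0 => h ?_
    have := Nat.find_spec hex
    rwa [h0, pow_zero, Ideal.one_eq_top, top_le_iff] at this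
  obtain ⟨z, hz, hzK⟩ := SetLike.not_le_iff_exists.1 (Nat.find_min hex (m := n) (by omega))
  refine ⟨z, hzK, le_trans ?_ (Nat.find_spec hex)⟩
  rw [hn, pow_succ']
  exact Ideal.mul_mono_right ((Ideal.span_singleton_le_iff_mem _).2 hz)

/-- In an Artinian local ring with socle of length at most one, `ℓ(0 : K) ≤ ℓ(A / K)`. -/
theorem idealLength_annihilator_add_le (hs : idealLength (maximalIdeal A).annihilator ≤ 1)
    (K : Ideal A) :
    idealLength K.annihilator + idealLength K ≤ idealLength (⊤ : Ideal A) := by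
  -- Induction downwards from K = A. For z in the socle of A/K, multiplication by z maps (0 : K)
  -- into the socle of A with kernel (0 : K + (z)). So in passing from K + (z) to K the annihilator
  -- gains at most one and the ideal loses at least one.
  induction K using WellFoundedGT.induction with
  | ind K ih =>
    rcases eq_or_ne K ⊤ with rfl | hK
    · have : (⊤ : Ideal A).annihilator = ⊥ := by
        rw [eq_bot_iff]
        intro a ha
        simpa using Submodule.mem_annihilator.1 ha 1 trivial
      rw [this, idealLength_bot, zero_add]
    · obtain ⟨z, hz, hmz⟩ := exists_notMem_maximalIdeal_mul_le hK
      have hlt : K < K ⊔ Ideal.span {z} :=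
        left_lt_sup.2 fun hle => hz (hle (Ideal.mem_span_singleton_self z))
      have h1 := ih _ hlt
      have h2 := idealLength_strictMono hlt
      have h3 := idealLength_map_add (LinearMap.mulRight A z) K.annihilator
      have e : K.annihilator ⊓ LinearMap.ker (LinearMap.mulRight A z) =
          (K ⊔ Ideal.span {z}).annihilator := by
        rw [Submodule.annihilator_sup]
        ext a
        simp [Ideal.span]
      have hle : Submodule.map (LinearMap.mulRight A z) K.annihilator ≤
          (maximalIdeal A).annihilator := by
        rintro _ ⟨a, ha, rfl⟩
        refine Submodule.mem_annihilator.2 fun b hb => ?_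
        have : b * z ∈ K := hmz (Ideal.mul_mem_mul hb (Ideal.mem_span_singleton_self z))
        have := Submodule.mem_annihilator.1 ha _ this
        rw [smul_eq_mul] at this ⊢
        rw [LinearMap.mulRight_apply, ← this]
        ring
      have h4 : idealLength (Submodule.map (LinearMap.mulRight A z) K.annihilator) ≤ 1 :=
        (idealLength_mono hle).trans hs
      rw [← coe_idealLength, e] at h3
      have h5 : idealLength (Submodule.map (LinearMap.mulRight A z) K.annihilator) +
        idealLength (K ⊔ Ideal.span {z}).annihilator = idealLength K.annihilator := by
        exact_mod_cast h3
      omega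

end IdealLength

/-! ### Restrictions on Hilbert functions of ideals of colength two -/

section Colength

open IsLocalRing

theorem MvPowerSeries.maximalIdeal_fin_two_eq_span (k : Type*) [Field k] :
    maximalIdeal (MvPowerSeries (Fin 2) k) = Ideal.span {MvPowerSeries.X 0, MvPowerSeries.X 1} := by
  apply le_antisymm
  · intro g hg
    have h0 : MvPowerSeries.constantCoeff g = 0 := by
      by_contra hne
      exact (mem_maximalIdeal _).1 hg
        (MvPowerSeries.isUnit_iff_constantCoeff.2 (isUnit_iff_ne_zero.2 hne))
    -- The terms of g free of x: x divides g - g₁, and y divides g₁ because g has no constant term.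
    let g₁ : MvPowerSeries (Fin 2) k := fun d => if d 0 = 0 then MvPowerSeries.coeff d g else 0
    have hc : ∀ d, MvPowerSeries.coeff d g₁ = if d 0 = 0 then MvPowerSeries.coeff d g else 0 :=
      fun d => rfl
    have hX : (MvPowerSeries.X 0 : MvPowerSeries (Fin 2) k) ∣ g - g₁ := by
      rw [MvPowerSeries.X_dvd_iff]
      intro d hd
      simp [hc, hd]
    have hY : (MvPowerSeries.X 1 : MvPowerSeries (Fin 2) k) ∣ g₁ := by
      rw [MvPowerSeries.X_dvd_iff]
      intro d hd
      rw [hc]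
      split_ifs with h
      · have : d = 0 := by
          ext i
          fin_cases i
          · exact h
          · exact hd
        rw [this, MvPowerSeries.coeff_zero_eq_constantCoeff_apply, h0]
      · rfl
    obtain ⟨a, ha⟩ := hX
    obtain ⟨b, hb⟩ := hY
    refine Ideal.mem_span_pair.2 ⟨a, b, ?_⟩
    rw [mul_comm a, mul_comm b, ← ha, ← hb]
    ring
  · rw [Ideal.span_le]
    rintro _ (rfl | rfl) <;>
    · refine (mem_maximalIdeal _).2 fun h => ?_
      simpa using MvPowerSeries.isUnit_constantCoeff _ h

theorem maximalIdeal_quotient_eq_map {R : Type*} [CommRing R] [IsLocalRing R] (J : Ideal R)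
    [IsLocalRing (R ⧸ J)] :
    maximalIdeal (R ⧸ J) = (maximalIdeal R).map (Ideal.Quotient.mk J) := by
  have h : (maximalIdeal (R ⧸ J)).comap (Ideal.Quotient.mk J) = maximalIdeal R :=
    eq_maximalIdeal (Ideal.comap_isMaximal_of_surjective _ Ideal.Quotient.mk_surjective)
  rw [← h, Ideal.map_comap_of_surjective _ Ideal.Quotient.mk_surjective]

theorem maximalIdeal_quotient_eq_sup {k : Type*} [Field k]
    (J : Ideal (MvPowerSeries (Fin 2) k)) [IsLocalRing (MvPowerSeries (Fin 2) k ⧸ J)] :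
    maximalIdeal (MvPowerSeries (Fin 2) k ⧸ J) =
      Ideal.span {Ideal.Quotient.mk J (MvPowerSeries.X 0)} ⊔
        Ideal.span {Ideal.Quotient.mk J (MvPowerSeries.X 1)} := by
  rw [maximalIdeal_quotient_eq_map, MvPowerSeries.maximalIdeal_fin_two_eq_span, Ideal.map_span,
    Set.image_pair, Ideal.span_insert]

variable {A : Type*} [CommRing A] [IsArtinianRing A]

theorem idealLength_lt_sup_span {K : Ideal A} {z : A} (h : z ∉ K) :
    idealLength K + 1 ≤ idealLength (K ⊔ Ideal.span {z}) :=
  idealLength_strictMono (left_lt_sup.2 fun hle => h (hle (Ideal.mem_span_singleton_self z)))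

variable [IsLocalRing A]

/-- Nakayama's lemma, applicable because every ideal of A is finitely generated. -/
theorem le_of_le_sup_maximalIdeal_mul {N K : Ideal A} (h : N ≤ K ⊔ maximalIdeal A * N) : N ≤ K :=
  Submodule.le_of_le_smul_of_le_jacobson_bot (IsNoetherian.noetherian N)
    (maximalIdeal_le_jacobson _) h

theorem maximalIdeal_mul_eq_bot_of_idealLength_le_one {K : Ideal A} (h : idealLength K ≤ 1) :
    maximalIdeal A * K = ⊥ := by
  rcases eq_or_lt_of_le (Ideal.mul_le_right : maximalIdeal A * K ≤ K) with he | hlt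
  · have : K ≤ ⊥ := le_of_le_sup_maximalIdeal_mul (by rw [he]; exact le_sup_right)
    rw [he]
    exact le_bot_iff.1 this
  · have h1 := idealLength_strictMono hlt
    refine (eq_of_le_of_idealLength_le bot_le ?_).symm
    omega

/-- An ideal of colength two contains the square of a parameter and a second parameter. -/
theorem exists_eq_span_sup_span_sq {p q : A}
    (hm : maximalIdeal A = Ideal.span {p} ⊔ Ideal.span {q}) {I : Ideal A}
    (hI : idealLength (⊤ : Ideal A) = 2 + idealLength I) :
    ∃ x y, maximalIdeal A = Ideal.span {x} ⊔ Ideal.span {y} ∧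
      I = Ideal.span {x} ⊔ Ideal.span {y ^ 2} := by
  have hItop : I ≠ ⊤ := by rintro rfl; omega
  have hIm : I ≤ maximalIdeal A := le_maximalIdeal hItop
  have hmtop : idealLength (⊤ : Ideal A) ≤ idealLength (maximalIdeal A) + 1 := by
    have := idealLength_sup_span_singleton_le (K := maximalIdeal A) (z := 1) (by simp)
    simpa using this
  have hlt : idealLength (maximalIdeal A) < idealLength (⊤ : Ideal A) :=
    idealLength_strictMono (lt_top_iff_ne_top.2 (Ideal.IsPrime.ne_top inferInstance))
  have hmlen : idealLength (maximalIdeal A) = idealLength I + 1 := by omega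
  -- Otherwise I + m² = m, as ℓ(m/I) = 1, and Nakayama gives m ≤ I.
  have hm2 : maximalIdeal A * maximalIdeal A ≤ I := by
    by_contra hnot
    have h1 : I < I ⊔ maximalIdeal A * maximalIdeal A := left_lt_sup.2 hnot
    have h2 : I ⊔ maximalIdeal A * maximalIdeal A = maximalIdeal A :=
      eq_of_le_of_idealLength_le (sup_le hIm Ideal.mul_le_left)
        (by have := idealLength_strictMono h1; omega)
    have h3 : maximalIdeal A ≤ I := le_of_le_sup_maximalIdeal_mul h2.ge
    have := idealLength_mono h3
    omega
  suffices main : ∀ p q : A, maximalIdeal A = Ideal.span {p} ⊔ Ideal.span {q} → p ∉ I →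
      ∃ x y, maximalIdeal A = Ideal.span {x} ⊔ Ideal.span {y} ∧
        I = Ideal.span {x} ⊔ Ideal.span {y ^ 2} by
    by_cases hp : p ∈ I
    · refine main q p (by rw [hm, sup_comm]) fun hq => ?_
      have : maximalIdeal A ≤ I := by
        rw [hm, sup_le_iff, Ideal.span_singleton_le_iff_mem, Ideal.span_singleton_le_iff_mem]
        exact ⟨hp, hq⟩
      have := idealLength_mono this
      omega
    · exact main p q hm hp
  intro p q hm hp
  have hpm : Ideal.span {p} ≤ maximalIdeal A := hm ▸ le_sup_left
  have hqm : Ideal.span {q} ≤ maximalIdeal A := hm ▸ le_sup_right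
  have hpm' : p ∈ maximalIdeal A := hpm (Ideal.mem_span_singleton_self p)
  have h1 : I ⊔ Ideal.span {p} = maximalIdeal A :=
    eq_of_le_of_idealLength_le (sup_le hIm hpm) (by have := idealLength_lt_sup_span hp; omega)
  -- Since m = I + (p), write q = x + c p with x ∈ I; then x replaces q as a generator of m.
  obtain ⟨x, hx, z, hz, hxz⟩ := Submodule.mem_sup.1 (h1.ge (hqm (Ideal.mem_span_singleton_self q)))
  obtain ⟨c, rfl⟩ := Ideal.mem_span_singleton'.1 hz
  have h2 : maximalIdeal A = Ideal.span {x} ⊔ Ideal.span {p} := by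
    apply le_antisymm
    · rw [hm, sup_le_iff, Ideal.span_singleton_le_iff_mem, Ideal.span_singleton_le_iff_mem, ← hxz]
      exact ⟨Ideal.mem_sup_right (Ideal.mem_span_singleton_self p), Ideal.add_mem _
        (Ideal.mem_sup_left (Ideal.mem_span_singleton_self x))
        (Ideal.mem_sup_right (Ideal.mul_mem_left _ _ (Ideal.mem_span_singleton_self p)))⟩
    · exact sup_le ((Ideal.span_singleton_le_iff_mem _).2 (hIm hx)) hpm
  refine ⟨x, p, h2, (eq_of_le_of_idealLength_le (sup_le ?_ ?_) ?_).symm⟩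
  · exact (Ideal.span_singleton_le_iff_mem _).2 hx
  · rw [Ideal.span_singleton_le_iff_mem, pow_two]
    exact hm2 (Ideal.mul_mem_mul hpm' hpm')
  -- The ideal (x, p²) has colength at most one in m, as m p lies in it; I has colength exactly one
  -- in m.
  · have h3 := idealLength_sup_span_singleton_le (K := Ideal.span {x} ⊔ Ideal.span {p ^ 2})
      (z := p) (by
        rw [h2, Ideal.sup_mul, Ideal.span_singleton_mul_span_singleton,
          Ideal.span_singleton_mul_span_singleton, ← pow_two]
        refine sup_le_sup_right ?_ _
        rw [Ideal.span_singleton_le_iff_mem]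
        exact Ideal.mul_mem_right _ _ (Ideal.mem_span_singleton_self x))
    have h4 : Ideal.span {x} ⊔ Ideal.span {p ^ 2} ⊔ Ideal.span {p} = maximalIdeal A := by
      rw [h2, sup_assoc]
      congr 1
      exact sup_eq_right.2 ((Ideal.span_singleton_le_iff_mem _).2
        (Ideal.mem_span_singleton.2 (dvd_pow_self p two_ne_zero)))
    rw [h4] at h3
    omega

end Colength

/-! ### Bounds on ℓ(I²/I³) from relations between generators -/

section Colength

open IsLocalRing

variable {A : Type*} [CommRing A]

theorem mem_pow_two {I : Ideal A} {a b : A} (ha : a ∈ I) (hb : b ∈ I) : a * b ∈ I ^ 2 :=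
  pow_two I ▸ Ideal.mul_mem_mul ha hb

theorem mem_pow_three {I : Ideal A} {a b : A} (ha : a ∈ I) (hb : b ∈ I ^ 2) : a * b ∈ I ^ 3 :=
  pow_succ' I 2 ▸ Ideal.mul_mem_mul ha hb

theorem sq_sup_span (v w : A) : (Ideal.span {v} ⊔ Ideal.span {w}) ^ 2 =
    Ideal.span {v ^ 2} ⊔ Ideal.span {v * w} ⊔ Ideal.span {w ^ 2} := by
  simp only [pow_two, Ideal.sup_mul, Ideal.mul_sup, Ideal.span_singleton_mul_span_singleton,
    mul_comm w v, sup_assoc]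
  rw [← sup_assoc (Ideal.span {v * w}), sup_idem]

theorem span_mul_sup_span (y v w : A) : Ideal.span {y} * (Ideal.span {v} ⊔ Ideal.span {w}) =
    Ideal.span {y * v} ⊔ Ideal.span {y * w} := by
  simp only [Ideal.mul_sup, Ideal.span_singleton_mul_span_singleton]

variable [IsLocalRing A]

/-- If `m = I + (y)`, then multiplying by `m` the multiples by `y` of elements of `Iⁿ` lands in
`Iⁿ⁺¹`. -/
theorem maximalIdeal_mul_span_mul_le {I : Ideal A} {y : A}
    (hm : maximalIdeal A = I ⊔ Ideal.span {y}) (hy : y ^ 2 ∈ I) {n : ℕ} {z : A} (hz : z ∈ I ^ n) :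
    maximalIdeal A * Ideal.span {y * z} ≤ I ^ (n + 1) := by
  rw [hm, Ideal.sup_mul, Ideal.span_singleton_mul_span_singleton, sup_le_iff,
    Ideal.span_singleton_le_iff_mem, pow_succ']
  refine ⟨Ideal.mul_mono_right ((Ideal.span_singleton_le_iff_mem _).2
    (Ideal.mul_mem_left _ _ hz)), ?_⟩
  rw [← mul_assoc, ← pow_two]
  exact Ideal.mul_mem_mul hy hz

theorem maximalIdeal_mul_span_le {I : Ideal A} {y : A}
    (hm : maximalIdeal A = I ⊔ Ideal.span {y}) {n : ℕ} {z : A} (hz : z ∈ I ^ n) :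
    maximalIdeal A * Ideal.span {z} ≤ I ^ (n + 1) ⊔ Ideal.span {y * z} := by
  rw [hm, Ideal.sup_mul, Ideal.span_singleton_mul_span_singleton, pow_succ']
  exact sup_le_sup_right (Ideal.mul_mono_right ((Ideal.span_singleton_le_iff_mem _).2 hz)) _

theorem maximalIdeal_mul_eq {I : Ideal A} {y : A}
    (hm : maximalIdeal A = I ⊔ Ideal.span {y}) (n : ℕ) :
    maximalIdeal A * I ^ n = I ^ (n + 1) ⊔ Ideal.span {y} * I ^ n := by
  rw [hm, Ideal.sup_mul, pow_succ']

theorem eq_sup_span_of_span {I : Ideal A} {x y : A}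
    (hm : maximalIdeal A = Ideal.span {x} ⊔ Ideal.span {y})
    (hI : I = Ideal.span {x} ⊔ Ideal.span {y ^ 2}) : maximalIdeal A = I ⊔ Ideal.span {y} := by
  rw [hm, hI, sup_assoc]
  congr 1
  exact (sup_eq_right.2 ((Ideal.span_singleton_le_iff_mem _).2
    (Ideal.mem_span_singleton.2 (dvd_pow_self y two_ne_zero)))).symm

theorem maximalIdeal_mul_eq_sup {I : Ideal A} {x y : A} (hm : maximalIdeal A = I ⊔ Ideal.span {y})
    (hI : I = Ideal.span {x} ⊔ Ideal.span {y ^ 2}) :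
    maximalIdeal A * I = I ^ 2 ⊔ Ideal.span {y * x} ⊔ Ideal.span {y * y ^ 2} := by
  have := maximalIdeal_mul_eq hm 1
  rw [pow_one] at this
  rw [this, sup_assoc, ← span_mul_sup_span, ← hI]

variable [IsArtinianRing A]

/-- The case of a principal ideal. -/
theorem idealLength_sq_le_of_principal {I : Ideal A} {y z : A}
    (hm : maximalIdeal A = I ⊔ Ideal.span {y}) (hy : y ^ 2 ∈ I) (hz : z ∈ I)
    (hI : I ≤ Ideal.span {z} ⊔ maximalIdeal A * I) :
    idealLength (I ^ 2) ≤ idealLength (I ^ 3) + 2 := by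
  have hIz : I = Ideal.span {z} :=
    le_antisymm (le_of_le_sup_maximalIdeal_mul hI) ((Ideal.span_singleton_le_iff_mem _).2 hz)
  have hz2 : z ^ 2 ∈ I ^ 2 := Ideal.pow_mem_pow hz 2
  -- Adjoining y z² and then z² to I³ reaches I², and each step adds length at most one.
  have h1 := idealLength_sup_span_singleton_le (maximalIdeal_mul_span_mul_le hm hy hz2)
  have h2 := idealLength_sup_span_singleton_le (maximalIdeal_mul_span_le hm hz2)
  have h3 : I ^ 2 ≤ I ^ (2 + 1) ⊔ Ideal.span {y * z ^ 2} ⊔ Ideal.span {z ^ 2} := by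
    conv_lhs => rw [hIz, Ideal.span_singleton_pow]
    exact le_sup_right
  have h4 := idealLength_mono h3
  norm_num at h1 h2 h4
  omega

/-- If `y v ∈ I²` for one of two generators `v, w` of `I`, and `I²` is generated by `r` and `w²`,
then `ℓ(I² / I³) ≤ 3`. -/
theorem idealLength_sq_le_of_generators {I : Ideal A} {y v w r : A}
    (hm : maximalIdeal A = I ⊔ Ideal.span {y}) (hy : y ^ 2 ∈ I)
    (hI : I = Ideal.span {v} ⊔ Ideal.span {w}) (hyv : y * v ∈ I ^ 2) (hr : r ∈ I ^ 2)
    (hI2 : I ^ 2 ≤ Ideal.span {r} ⊔ Ideal.span {w ^ 2} ⊔ maximalIdeal A * I ^ 2) :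
    idealLength (I ^ 2) ≤ idealLength (I ^ 3) + 3 := by
  have hv : v ∈ I := hI.ge (Ideal.mem_sup_left (Ideal.mem_span_singleton_self v))
  have hw : w ∈ I := hI.ge (Ideal.mem_sup_right (Ideal.mem_span_singleton_self w))
  have hw2 : w ^ 2 ∈ I ^ 2 := Ideal.pow_mem_pow hw 2
  -- Of the products of y with v², v w, w², the first two lie in I³ because y v ∈ I². So I² is
  -- reached from I³ by adjoining y w², r and w² one at a time.
  have hmI : maximalIdeal A * I ^ 2 ≤ I ^ 3 ⊔ Ideal.span {y * w ^ 2} := by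
    rw [maximalIdeal_mul_eq hm, sup_le_iff]
    refine ⟨le_sup_left, ?_⟩
    conv_lhs => rw [hI, sq_sup_span]
    simp only [Ideal.mul_sup, Ideal.span_singleton_mul_span_singleton]
    refine sup_le (sup_le ?_ ?_) le_sup_right <;>
      refine le_trans ((Ideal.span_singleton_le_iff_mem _).2 ?_) le_sup_left
    · convert mem_pow_three hv hyv using 1; ring
    · convert mem_pow_three hw hyv using 1; ring
  have h1 := idealLength_sup_span_singleton_le (maximalIdeal_mul_span_mul_le hm hy hw2)
  have h2 := idealLength_sup_span_singleton_le (K := I ^ 3 ⊔ Ideal.span {y * w ^ 2}) (z := r)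
    ((Ideal.mul_mono_right ((Ideal.span_singleton_le_iff_mem _).2 hr)).trans hmI)
  have h3 := idealLength_sup_span_singleton_le
    (K := I ^ 3 ⊔ Ideal.span {y * w ^ 2} ⊔ Ideal.span {r}) (z := w ^ 2)
    ((Ideal.mul_mono_right ((Ideal.span_singleton_le_iff_mem _).2 hw2)).trans
      (hmI.trans le_sup_left))
  have h4 := idealLength_mono ((le_of_le_sup_maximalIdeal_mul hI2).trans
    (sup_le_sup_right (le_sup_right : Ideal.span {r} ≤ I ^ 3 ⊔ Ideal.span {y * w ^ 2} ⊔ _) _))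
  norm_num at h1
  omega

variable {I : Ideal A} {x y : A}

/-- Two generators of `I` contribute at most two to `ℓ(I / m I)`. -/
theorem idealLength_le_maximalIdeal_mul_add_two (hI : I = Ideal.span {x} ⊔ Ideal.span {y ^ 2}) :
    idealLength I ≤ idealLength (maximalIdeal A * I) + 2 := by
  have hx : Ideal.span {x} ≤ I := hI ▸ le_sup_left
  have ht : Ideal.span {y ^ 2} ≤ I := hI ▸ le_sup_right
  have h1 := idealLength_sup_span_singleton_le (Ideal.mul_mono_right hx)
  have h2 := idealLength_sup_span_singleton_le (K := maximalIdeal A * I ⊔ Ideal.span {x})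
    (z := y ^ 2) ((Ideal.mul_mono_right ht).trans le_sup_left)
  have h3 : I ≤ maximalIdeal A * I ⊔ Ideal.span {x} ⊔ Ideal.span {y ^ 2} := by
    rw [sup_assoc, ← hI]; exact le_sup_right
  have := idealLength_mono h3
  omega

/-- Either `I` is principal up to `ℓ(I² / I³) ≤ 2`, or `ℓ(I / m I) = 2`. -/
theorem idealLength_sq_le_or_add_two_le (hm : maximalIdeal A = I ⊔ Ideal.span {y})
    (hI : I = Ideal.span {x} ⊔ Ideal.span {y ^ 2}) :
    idealLength (I ^ 2) ≤ idealLength (I ^ 3) + 2 ∨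
      idealLength (maximalIdeal A * I) + 2 ≤ idealLength I := by
  have hx : x ∈ I := hI.ge (Ideal.mem_sup_left (Ideal.mem_span_singleton_self x))
  have ht : y ^ 2 ∈ I := hI.ge (Ideal.mem_sup_right (Ideal.mem_span_singleton_self _))
  by_cases h1 : x ∈ maximalIdeal A * I
  · refine Or.inl (idealLength_sq_le_of_principal hm ht ht ?_)
    conv_lhs => rw [hI]
    exact sup_le (le_sup_of_le_right ((Ideal.span_singleton_le_iff_mem _).2 h1)) le_sup_left
  by_cases h2 : y ^ 2 ∈ maximalIdeal A * I ⊔ Ideal.span {x}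
  · refine Or.inl (idealLength_sq_le_of_principal hm ht hx ?_)
    conv_lhs => rw [hI]
    refine sup_le le_sup_left ((Ideal.span_singleton_le_iff_mem _).2 ?_)
    rwa [sup_comm]
  · right
    have h3 := idealLength_lt_sup_span h1
    have h4 := idealLength_lt_sup_span h2
    have h5 : maximalIdeal A * I ⊔ Ideal.span {x} ⊔ Ideal.span {y ^ 2} ≤ I := by
      rw [sup_assoc, ← hI]; exact sup_le Ideal.mul_le_right le_rfl
    have := idealLength_mono h5
    omega

/-- The module mI/I² is generated by the classes of y x and y³. If I needs two generators, the
hypothesis leaves it length at most one, so y v ∈ I² for v = x or for v = y² - c x, a member of a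
generating pair. Then `idealLength_sq_le_of_generators` applies. -/
theorem idealLength_sq_le_add_three (hm : maximalIdeal A = I ⊔ Ideal.span {y})
    (hI : I = Ideal.span {x} ⊔ Ideal.span {y ^ 2})
    (h : idealLength I ≤ idealLength (I ^ 2) + 3) :
    idealLength (I ^ 2) ≤ idealLength (I ^ 3) + 3 := by
  have hx : x ∈ I := hI.ge (Ideal.mem_sup_left (Ideal.mem_span_singleton_self x))
  have ht : y ^ 2 ∈ I := hI.ge (Ideal.mem_sup_right (Ideal.mem_span_singleton_self _))
  have hym : y ∈ maximalIdeal A := hm ▸ Ideal.mem_sup_right (Ideal.mem_span_singleton_self _)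
  by_cases h1 : y * x ∈ I ^ 2
  · refine idealLength_sq_le_of_generators hm ht hI h1 (Ideal.pow_mem_pow hx 2) ?_
    conv_lhs => rw [hI, sq_sup_span]
    refine sup_le (sup_le (le_sup_of_le_left le_sup_left) ?_) (le_sup_of_le_left le_sup_right)
    refine le_sup_of_le_right ((Ideal.span_singleton_le_iff_mem _).2 ?_)
    convert Ideal.mul_mem_mul hym h1 using 1
    ring
  by_cases h2 : y * y ^ 2 ∈ I ^ 2 ⊔ Ideal.span {y * x}
  · obtain ⟨i, hi, z, hz, hiz⟩ := Submodule.mem_sup.1 h2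
    obtain ⟨c, rfl⟩ := Ideal.mem_span_singleton'.1 hz
    have hI' : I = Ideal.span {y ^ 2 - c * x} ⊔ Ideal.span {x} := by
      rw [hI]
      apply le_antisymm <;> rw [sup_le_iff, Ideal.span_singleton_le_iff_mem,
        Ideal.span_singleton_le_iff_mem, ← Ideal.span_insert, Ideal.mem_span_pair,
        Ideal.mem_span_pair]
      · exact ⟨⟨0, 1, by ring⟩, ⟨1, c, by ring⟩⟩
      · exact ⟨⟨-c, 1, by ring⟩, ⟨1, 0, by ring⟩⟩
    have hyv : y * (y ^ 2 - c * x) ∈ I ^ 2 := by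
      convert hi using 1
      linear_combination -hiz
    refine idealLength_sq_le_of_generators (r := (y ^ 2 - c * x) * x) hm ht hI' hyv
      (mem_pow_two (Ideal.sub_mem _ ht (Ideal.mul_mem_left _ _ hx)) hx) ?_
    conv_lhs => rw [hI', sq_sup_span]
    refine sup_le (sup_le ?_ (le_sup_of_le_left le_sup_left)) (le_sup_of_le_left le_sup_right)
    rw [Ideal.span_singleton_le_iff_mem]
    -- With v = y² - c x and y v ∈ I², this shows that v² is a multiple of v x modulo m I².
    have e : (y ^ 2 - c * x) ^ 2 = -c * ((y ^ 2 - c * x) * x) + y * (y * (y ^ 2 - c * x)) := by ring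
    rw [e]
    exact Ideal.add_mem _ (Ideal.mem_sup_left (Ideal.mem_sup_left
      (Ideal.mul_mem_left _ _ (Ideal.mem_span_singleton_self _))))
      (Ideal.mem_sup_right (Ideal.mul_mem_mul hym hyv))
  -- Here ℓ(mI/I²) ≥ 2, which together with ℓ(I/mI) = 2 would contradict the hypothesis.
  · have h3 := idealLength_lt_sup_span h1
    have h4 := idealLength_lt_sup_span h2
    rw [← maximalIdeal_mul_eq_sup hm hI] at h4
    rcases idealLength_sq_le_or_add_two_le hm hI with h5 | h5 <;> omega

/-- If ℓ(I/mI) = 2, the hypothesis forces I² = mI, hence m I² = I³. Then y³ ∈ I², so y⁴ ∈ m I², and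
x², x y² generate I² modulo I³, which m annihilates. -/
theorem idealLength_sq_le_add_two (hm : maximalIdeal A = I ⊔ Ideal.span {y})
    (hI : I = Ideal.span {x} ⊔ Ideal.span {y ^ 2})
    (h : idealLength I ≤ idealLength (I ^ 2) + 2) :
    idealLength (I ^ 2) ≤ idealLength (I ^ 3) + 2 := by
  rcases idealLength_sq_le_or_add_two_le hm hI with h5 | h5
  · exact h5
  have hx : x ∈ I := hI.ge (Ideal.mem_sup_left (Ideal.mem_span_singleton_self x))
  have ht : y ^ 2 ∈ I := hI.ge (Ideal.mem_sup_right (Ideal.mem_span_singleton_self _))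
  have hym : y ∈ maximalIdeal A := hm ▸ Ideal.mem_sup_right (Ideal.mem_span_singleton_self _)
  have hIm : I ≤ maximalIdeal A := hm ▸ le_sup_left
  have hmI : I ^ 2 = maximalIdeal A * I := by
    refine eq_of_le_of_idealLength_le ?_ (by omega)
    rw [pow_two]
    exact Ideal.mul_mono_left hIm
  have hmI2 : maximalIdeal A * I ^ 2 = I ^ 3 := by
    rw [pow_two, ← mul_assoc, ← hmI, ← pow_succ]
  have hle : I ^ 2 ≤ Ideal.span {x ^ 2} ⊔ Ideal.span {x * y ^ 2} ⊔ maximalIdeal A * I ^ 2 := by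
    conv_lhs => rw [hI, sq_sup_span]
    refine sup_le le_sup_left (le_sup_of_le_right ((Ideal.span_singleton_le_iff_mem _).2 ?_))
    have : y * y ^ 2 ∈ I ^ 2 := hmI ▸ Ideal.mul_mem_mul hym ht
    convert Ideal.mul_mem_mul hym this using 1
    ring
  have h1 := idealLength_sup_span_singleton_le (K := I ^ 3) (z := x ^ 2) (by
    rw [← hmI2]
    exact Ideal.mul_mono_right ((Ideal.span_singleton_le_iff_mem _).2 (Ideal.pow_mem_pow hx 2)))
  have h2 := idealLength_sup_span_singleton_le (K := I ^ 3 ⊔ Ideal.span {x ^ 2})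
    (z := x * y ^ 2) (by
    refine le_trans ?_ (le_sup_left)
    rw [← hmI2]
    exact Ideal.mul_mono_right ((Ideal.span_singleton_le_iff_mem _).2 (mem_pow_two hx ht)))
  have h3 := idealLength_mono ((le_of_le_sup_maximalIdeal_mul hle).trans
    (sup_le_sup_right (le_sup_right : Ideal.span {x ^ 2} ≤ I ^ 3 ⊔ _) _))
  omega

end Colength

/-! ### Bounds from duality -/

section Colength

open IsLocalRing

variable {A : Type*} [CommRing A] [IsArtinianRing A] [IsLocalRing A] {I : Ideal A} {x y : A}

theorem mem_annihilator_of_generators {R : Type*} [CommRing R] {I : Ideal R} {u w z : R}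
    (hI : I = Ideal.span {u} ⊔ Ideal.span {w}) (hu : z * u = 0) (hw : z * w = 0) :
    z ∈ I.annihilator := by
  refine Submodule.mem_annihilator.2 fun b hb => ?_
  rw [hI, ← Ideal.span_insert, Ideal.mem_span_pair] at hb
  obtain ⟨a, c, rfl⟩ := hb
  rw [smul_eq_mul]
  linear_combination a * hu + c * hw

theorem le_annihilator_of_mul_eq_bot {R : Type*} [CommRing R] {K L : Ideal R} (h : K * L = ⊥) :
    K ≤ L.annihilator := fun a ha =>
  Submodule.mem_annihilator.2 fun b hb => by
    have := h.le (Ideal.mul_mem_mul ha hb)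
    simpa using this

/-- If `I³ = 0` and `I²` is simple, then `ℓ(I) ≤ 4`. -/
theorem idealLength_le_four_of_pow_three_eq_bot
    (hs : idealLength (maximalIdeal A).annihilator ≤ 1)
    (hI : I = Ideal.span {x} ⊔ Ideal.span {y ^ 2})
    (h0 : idealLength (⊤ : Ideal A) = 2 + idealLength I)
    (h2 : idealLength (I ^ 2) ≤ 1) : idealLength I ≤ 4 := by
  -- m I · I = m I² = 0, so ℓ(mI) ≤ ℓ(0 : I) ≤ ℓ(A/I) = 2, and ℓ(I/mI) ≤ 2.
  have h3 : maximalIdeal A * I ≤ I.annihilator := by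
    refine le_annihilator_of_mul_eq_bot ?_
    rw [mul_assoc, ← pow_two]
    exact maximalIdeal_mul_eq_bot_of_idealLength_le_one h2
  have h4 := idealLength_mono h3
  have h5 := idealLength_annihilator_add_le hs I
  have h6 := idealLength_le_maximalIdeal_mul_add_two hI
  omega

/-- If `I⁴ = 0` and `I³` is simple, then `ℓ(I²) ≤ 4`. -/
theorem idealLength_sq_le_four (hs : idealLength (maximalIdeal A).annihilator ≤ 1)
    (hI : I = Ideal.span {x} ⊔ Ideal.span {y ^ 2})
    (h0 : idealLength (⊤ : Ideal A) = 2 + idealLength I)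
    (h3 : idealLength (I ^ 3) ≤ 1) : idealLength (I ^ 2) ≤ 4 := by
  have hx : x ∈ I := hI.ge (Ideal.mem_sup_left (Ideal.mem_span_singleton_self x))
  have ht : y ^ 2 ∈ I := hI.ge (Ideal.mem_sup_right (Ideal.mem_span_singleton_self _))
  -- Multiplication by v sends L into I³, of length at most one. Cutting I² by the kernels of x and
  -- of y² therefore costs at most two and ends inside (0 : I), of length at most two.
  have key : ∀ (L : Ideal A) (v : A), L ≤ I ^ 2 → v ∈ I →
      idealLength L ≤ idealLength (L ⊓ LinearMap.ker (LinearMap.mulRight A v)) + 1 := by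
    intro L v hL hv
    have h1 := idealLength_map_add (LinearMap.mulRight A v) L
    have h4 : Submodule.map (LinearMap.mulRight A v) L ≤ I ^ 3 := by
      rintro _ ⟨a, ha, rfl⟩
      rw [LinearMap.mulRight_apply, mul_comm]
      exact mem_pow_three hv (hL ha)
    have h5 := (idealLength_mono h4).trans h3
    rw [← coe_idealLength] at h1
    have h6 : idealLength (Submodule.map (LinearMap.mulRight A v) L) +
        idealLength (L ⊓ LinearMap.ker (LinearMap.mulRight A v)) = idealLength L := by
      exact_mod_cast h1
    omega
  have h1 := key _ x le_rfl hx
  have h2 := key _ (y ^ 2) (inf_le_left : I ^ 2 ⊓ LinearMap.ker (LinearMap.mulRight A x) ≤ I ^ 2) ht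
  have h4 : I ^ 2 ⊓ LinearMap.ker (LinearMap.mulRight A x) ⊓
      LinearMap.ker (LinearMap.mulRight A (y ^ 2)) ≤ I.annihilator := by
    rintro z ⟨⟨-, hzx⟩, hzt⟩
    exact mem_annihilator_of_generators hI hzx hzt
  have h5 := idealLength_mono h4
  have h6 := idealLength_annihilator_add_le hs I
  omega

/-- I² annihilates itself, so ℓ(I²) ≤ ℓ(0 : I²) ≤ ℓ(A/I²). -/
theorem idealLength_sq_le_of_pow_four_eq_bot
    (hs : idealLength (maximalIdeal A).annihilator ≤ 1) (h4 : I ^ 4 = ⊥) :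
    idealLength (I ^ 2) + idealLength (I ^ 2) ≤ idealLength (⊤ : Ideal A) := by
  have h : I ^ 2 ≤ (I ^ 2).annihilator :=
    le_annihilator_of_mul_eq_bot (by rw [← pow_add, h4])
  have h1 := idealLength_mono h
  have h2 := idealLength_annihilator_add_le hs (I ^ 2)
  omega

/-- If `I⁴ = 0`, `I³` is simple and `I²` has length two, then `ℓ(I) ≤ 5`. -/
theorem idealLength_le_five (hs : idealLength (maximalIdeal A).annihilator ≤ 1)
    (hm : maximalIdeal A = I ⊔ Ideal.span {y}) (hI : I = Ideal.span {x} ⊔ Ideal.span {y ^ 2})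
    (h0 : idealLength (⊤ : Ideal A) = 2 + idealLength I)
    (h2 : idealLength (I ^ 2) = 2) (h3 : idealLength (I ^ 3) = 1) (h4 : I ^ 4 = ⊥) :
    idealLength I ≤ 5 := by
  have hIm : I ≤ maximalIdeal A := hm ▸ le_sup_left
  have hym : y ∈ maximalIdeal A := hm ▸ Ideal.mem_sup_right (Ideal.mem_span_singleton_self _)
  have hm3 : maximalIdeal A * I ^ 3 = ⊥ := maximalIdeal_mul_eq_bot_of_idealLength_le_one h3.le
  have h32 : I ^ 3 ≤ I ^ 2 := Ideal.pow_le_pow_right (by norm_num)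
  have h3m : I ^ 3 ≤ maximalIdeal A * I ^ 2 := by
    rw [pow_succ']; exact Ideal.mul_mono_left hIm
  have hm2 : maximalIdeal A * I ^ 2 = I ^ 3 := by
    have hlt : maximalIdeal A * I ^ 2 < I ^ 2 := by
      refine lt_of_le_of_ne Ideal.mul_le_right fun he => ?_
      have : I ^ 2 ≤ ⊥ := le_of_le_sup_maximalIdeal_mul (by rw [he]; exact le_sup_right)
      have := idealLength_mono this
      rw [idealLength_bot] at this
      omega
    have := idealLength_strictMono hlt
    exact (eq_of_le_of_idealLength_le h3m (by omega)).symm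
  obtain ⟨g, hg, hg3⟩ : ∃ g ∈ I ^ 2, g ∉ I ^ 3 := by
    by_contra! hcon
    have := idealLength_mono (hcon : I ^ 2 ≤ I ^ 3)
    omega
  have hI2 : I ^ 2 = Ideal.span {g} := by
    refine le_antisymm (le_of_le_sup_maximalIdeal_mul ?_)
      ((Ideal.span_singleton_le_iff_mem _).2 hg)
    rw [hm2, sup_comm]
    refine (eq_of_le_of_idealLength_le (sup_le h32 ((Ideal.span_singleton_le_iff_mem _).2 hg))
      ?_).ge
    have := idealLength_lt_sup_span hg3
    omega
  have hmI := idealLength_le_maximalIdeal_mul_add_two hI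
  -- As I³ = I · (g) ≠ 0, one of the two generators of I does not kill g. The bound ℓ(mI) ≤ 3
  -- suffices because ℓ(I/mI) ≤ 2.
  suffices main : ∀ u w : A, I = Ideal.span {u} ⊔ Ideal.span {w} → u * g ≠ 0 →
      idealLength (maximalIdeal A * I) ≤ 3 by
    by_cases hxg : x * g = 0
    · by_cases htg : y ^ 2 * g = 0
      · have : I ^ 3 ≤ ⊥ := by
          rw [pow_succ', hI2, hI, Ideal.sup_mul, Ideal.span_singleton_mul_span_singleton,
            Ideal.span_singleton_mul_span_singleton, hxg, htg]
          simp
        have := idealLength_mono this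
        rw [idealLength_bot] at this
        omega
      · have := main (y ^ 2) x (by rw [hI, sup_comm]) htg
        omega
    · have := main x (y ^ 2) hI hxg
      omega
  clear hmI hI
  intro u w' hI hug
  have hu : u ∈ I := hI.ge (Ideal.mem_sup_left (Ideal.mem_span_singleton_self u))
  have hw' : w' ∈ I := hI.ge (Ideal.mem_sup_right (Ideal.mem_span_singleton_self w'))
  have hI3 : I ^ 3 = Ideal.span {u * g} := by
    refine (eq_of_le_of_idealLength_le ((Ideal.span_singleton_le_iff_mem _).2
      (mem_pow_three hu hg)) ?_).symm
    have : (⊥ : Ideal A) < Ideal.span {u * g} :=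
      bot_lt_iff_ne_bot.2 fun h => hug (Ideal.span_singleton_eq_bot.1 h)
    have := idealLength_strictMono this
    omega
  obtain ⟨c, hc⟩ := Ideal.mem_span_singleton'.1 (hI3.le (mem_pow_three hw' hg))
  -- I³ = (u g), so subtracting a multiple of u from the second generator makes it kill g, hence I².
  obtain ⟨w, rfl⟩ : ∃ w, w' = w + c * u := ⟨w' - c * u, by ring⟩
  have hwg : w * g = 0 := by linear_combination -hc
  have hIw : I = Ideal.span {u} ⊔ Ideal.span {w} := by
    rw [hI]
    apply le_antisymm <;> rw [sup_le_iff, Ideal.span_singleton_le_iff_mem,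
      Ideal.span_singleton_le_iff_mem, ← Ideal.span_insert, Ideal.mem_span_pair,
      Ideal.mem_span_pair]
    · exact ⟨⟨1, 0, by ring⟩, ⟨c, 1, by ring⟩⟩
    · exact ⟨⟨1, 0, by ring⟩, ⟨-c, 1, by ring⟩⟩
  have hw : w ∈ I := hIw.ge (Ideal.mem_sup_right (Ideal.mem_span_singleton_self w))
  have hw2 : ∀ a ∈ I ^ 2, w * a = 0 := by
    intro a ha
    obtain ⟨b, rfl⟩ := Ideal.mem_span_singleton'.1 (hI2.le ha)
    linear_combination b * hwg
  -- Write w v = b g. Multiplying by u gives b u g = 0, so b is not a unit and b g ∈ m I² = I³.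
  have hmem : ∀ v ∈ I, w * v ∈ I ^ 3 := by
    intro v hv
    obtain ⟨b, hb⟩ := Ideal.mem_span_singleton'.1 (hI2.le (mem_pow_two hw hv))
    have h5 : b * (u * g) = 0 := by
      have := hw2 _ (mem_pow_two hu hv)
      linear_combination u * hb + this
    have hbm : b ∈ maximalIdeal A := by
      refine (mem_maximalIdeal _).2 fun hunit => hug ?_
      exact (hunit.mul_right_eq_zero).1 h5
    rw [← hm2, ← hb]
    exact Ideal.mul_mem_mul hbm hg
  have hy3 : ∀ a ∈ I ^ 3, y * a = 0 := fun a ha => by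
    simpa using hm3.le (Ideal.mul_mem_mul hym ha)
  have hu2 : u ^ 2 ∈ I ^ 2 := Ideal.pow_mem_pow hu 2
  have hI2u : I ^ 2 = Ideal.span {u ^ 2} := by
    refine le_antisymm (le_of_le_sup_maximalIdeal_mul ?_)
      ((Ideal.span_singleton_le_iff_mem _).2 hu2)
    rw [hm2]
    conv_lhs => rw [hIw, sq_sup_span]
    refine sup_le (sup_le le_sup_left ?_) ?_ <;>
      refine le_sup_of_le_right ((Ideal.span_singleton_le_iff_mem _).2 ?_)
    · rw [mul_comm]; exact hmem u hu
    · rw [pow_two]; exact hmem w hw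
  have hI3u : I ^ 3 = Ideal.span {u * u ^ 2} := by
    rw [pow_succ', hI2u]
    conv_lhs => rw [hIw]
    rw [Ideal.sup_mul, Ideal.span_singleton_mul_span_singleton,
      Ideal.span_singleton_mul_span_singleton, hw2 _ hu2]
    simp
  -- Since y u² ∈ m I² = (u³), some d makes y u - d u² kill u. It also kills w, because y kills w u
  -- ∈ I³ and w kills I².
  obtain ⟨d, hd⟩ := Ideal.mem_span_singleton'.1
    (hI3u.le (hm2.le (Ideal.mul_mem_mul hym hu2)))
  have hz : y * u - d * u ^ 2 ∈ I.annihilator := by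
    refine mem_annihilator_of_generators hIw ?_ ?_
    · linear_combination -hd
    · linear_combination hy3 _ (hmem u hu) - d * hw2 _ hu2
  have hyw : y * w ∈ I.annihilator := by
    refine mem_annihilator_of_generators hIw ?_ ?_
    · linear_combination hy3 _ (hmem u hu)
    · linear_combination hy3 _ (hmem w hw)
  -- mI = (u²) + (y u, y w) is contained in (0 : I) + (u²). As m u² ⊆ I³ kills I, the length is at
  -- most ℓ(0 : I) + 1 ≤ 3.
  have hle : maximalIdeal A * I ≤ I.annihilator ⊔ Ideal.span {u ^ 2} := by
    have := maximalIdeal_mul_eq hm 1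
    rw [pow_one] at this
    rw [this, hI2u]
    refine sup_le le_sup_right ?_
    conv_lhs => rw [hIw, span_mul_sup_span]
    refine sup_le ?_ ?_ <;> rw [Ideal.span_singleton_le_iff_mem]
    · exact Submodule.mem_sup.2 ⟨_, hz, d * u ^ 2,
        Ideal.mul_mem_left _ _ (Ideal.mem_span_singleton_self _), by ring⟩
    · exact Ideal.mem_sup_left hyw
  have hlast := idealLength_sup_span_singleton_le (K := I.annihilator) (z := u ^ 2) (by
    rw [← hI2u, hm2]
    exact le_annihilator_of_mul_eq_bot (by rw [← pow_succ, h4]))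
  have h5 := idealLength_mono hle
  have h6 := idealLength_annihilator_add_le hs I
  omega

end Colength

/-! ### The necessary conditions -/

section Necessary

open IsLocalRing

variable {A : Type*} [CommRing A] [IsArtinianRing A] [IsLocalRing A] {I : Ideal A}

/-- Vanishing in degree u + 1 means Iᵘ⁺¹ = Iᵘ⁺², and Nakayama applies because H 0 ≠ 0 makes I
proper. -/
theorem pow_eq_bot_of_hasEndDegree {H : ℕ → ℕ} (hH : ∀ n, hilbertG I n = (H n : ℕ∞)) {u : ℕ}
    (hu : ∀ n, u < n → H n = 0) (h0 : H 0 ≠ 0) : I ^ (u + 1) = ⊥ := by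
  have hI : I ≤ maximalIdeal A := by
    refine le_maximalIdeal ?_
    rintro rfl
    have := idealLength_pow_eq ⊤ hH 0
    simp at this
    exact h0 this
  have h1 := idealLength_pow_eq I hH (u + 1)
  rw [hu _ (Nat.lt_succ_self u), zero_add] at h1
  have h2 := eq_of_le_of_idealLength_le (Ideal.pow_le_pow_right (u + 1).le_succ) h1.le
  refine le_bot_iff.1 (le_of_le_sup_maximalIdeal_mul ?_)
  rw [bot_sup_eq]
  conv_lhs => rw [← h2, pow_succ']
  exact Ideal.mul_mono_left hI

/-- The conditions satisfied by the Hilbert function of an ideal of colength two. -/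
structure ColengthTwoConditions (H : ℕ → ℕ) : Prop where
  last_le {u : ℕ} : (∀ n, u < n → H n = 0) → H u ≤ 2
  two_le_two : H 1 ≤ 2 → H 2 ≤ 2
  two_le_three : H 1 ≤ 3 → H 2 ≤ 3
  one_le_three : (∀ n, 2 < n → H n = 0) → H 2 = 1 → H 1 ≤ 3
  two_add_three_le : (∀ n, 3 < n → H n = 0) → H 2 + H 3 ≤ 2 + H 1
  two_le_three_of_last : (∀ n, 3 < n → H n = 0) → H 3 = 1 → H 2 ≤ 3
  one_le_three_of_last : (∀ n, 3 < n → H n = 0) → H 3 = 1 → H 2 = 1 → H 1 ≤ 3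

theorem colengthTwoConditions_of_maximalIdeal_eq
    (hs : idealLength (maximalIdeal A).annihilator ≤ 1) {p q : A}
    (hm : maximalIdeal A = Ideal.span {p} ⊔ Ideal.span {q}) {H : ℕ → ℕ}
    (hH : ∀ n, hilbertG I n = (H n : ℕ∞)) (hH0 : H 0 = 2) : ColengthTwoConditions H := by
  have hl := idealLength_pow_eq I hH
  have h0 : idealLength (⊤ : Ideal A) = 2 + idealLength I := by
    have := hl 0
    rwa [pow_zero, Ideal.one_eq_top, zero_add, pow_one, hH0] at this
  have h1 : idealLength I = H 1 + idealLength (I ^ 2) := by simpa using hl 1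
  have h2 : idealLength (I ^ 2) = H 2 + idealLength (I ^ 3) := hl 2
  have h3 : idealLength (I ^ 3) = H 3 + idealLength (I ^ 4) := hl 3
  obtain ⟨x, y, hxy, hI⟩ := exists_eq_span_sup_span_sq hm h0
  have hmI := eq_sup_span_of_span hxy hI
  have hbot : ∀ u, (∀ n, u < n → H n = 0) → I ^ (u + 1) = ⊥ := fun u hu =>
    pow_eq_bot_of_hasEndDegree hH hu (by omega)
  have hzero : ∀ u, (∀ n, u < n → H n = 0) → idealLength (I ^ (u + 1)) = 0 := fun u hu => by
    rw [hbot u hu, idealLength_bot]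
  refine ⟨fun {u} hu => ?_, fun h => ?_, fun h => ?_, fun hu h => ?_, fun hu => ?_,
    fun hu h => ?_, fun hu h h' => ?_⟩
  · have h4 : I ^ u ≤ I.annihilator :=
      le_annihilator_of_mul_eq_bot (by rw [← pow_succ, hbot u hu])
    have h5 := idealLength_mono h4
    have h6 := idealLength_annihilator_add_le hs I
    have h7 := hl u
    omega
  · have := idealLength_sq_le_add_two hmI hI (by omega)
    omega
  · have := idealLength_sq_le_add_three hmI hI (by omega)
    omega
  · have h4 : idealLength (I ^ 3) = 0 := hzero 2 hu
    have := idealLength_le_four_of_pow_three_eq_bot hs hI h0 (by omega)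
    omega
  · have h4 : idealLength (I ^ 4) = 0 := hzero 3 hu
    have := idealLength_sq_le_of_pow_four_eq_bot hs (hbot 3 hu)
    omega
  · have h4 : idealLength (I ^ 4) = 0 := hzero 3 hu
    have := idealLength_sq_le_four hs hI h0 (by omega)
    omega
  · have h4 : idealLength (I ^ 4) = 0 := hzero 3 hu
    have := idealLength_le_five hs hmI hI h0 (by omega) (by omega) (hbot 3 hu)
    omega

theorem colengthTwoConditions_of_isIGorenstein {k : Type*} [Field k] {H : ℕ → ℕ}
    (h : IsIGorenstein k H) (hH0 : H 0 = 2) : ColengthTwoConditions H := by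
  obtain ⟨J, ⟨hA, hloc, hs⟩, I, hI⟩ := h
  refine colengthTwoConditions_of_maximalIdeal_eq ?_ (maximalIdeal_quotient_eq_sup J) hI hH0
  rw [← coe_idealLength] at hs
  exact_mod_cast hs.le

end Necessary

/-! ### Algebras with a basis adapted to the powers of an ideal and to their annihilators -/

section AdaptedBasis

open IsLocalRing

/-- The residue field of A is k, so lengths over A can be computed as dimensions over k. -/
theorem IsLocalRing.length_eq_length_of_residue {k A : Type*} [Field k] [CommRing A] [IsLocalRing A]
    [Algebra k A] (hres : ∀ a : A, ∃ c : k, a - algebraMap k A c ∈ maximalIdeal A)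
    (M : Type*) [AddCommGroup M] [Module k M] [Module A M] [IsScalarTower k A M] :
    Module.length k M = Module.length A M := by
  have hsurj : Function.Surjective (algebraMap (ResidueField k) (ResidueField A)) := by
    intro z
    obtain ⟨a, rfl⟩ := residue_surjective z
    obtain ⟨c, hc⟩ := hres a
    refine ⟨residue k c, ?_⟩
    rw [ResidueField.algebraMap_residue, eq_comm, ← sub_eq_zero, ← map_sub, residue_eq_zero_iff]
    exact hc
  rw [IsLocalRing.length_restrictScalars k A M, Module.length_eq_of_surjective hsurj,
    Module.length_eq_one (ResidueField A) (ResidueField A), mul_one]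

variable {k A ι : Type*} [Field k] [CommRing A] [Algebra k A]

/-! ### Self-dual families and the Gorenstein property -/

section SelfDual

variable [DecidableEq ι]

/-- A family which is, up to a permutation, its own dual family for the pairing `φ (a b)`, and
which detects zero under this pairing. -/
structure IsSelfDualFamily (φ : A →ₗ[k] k) (e : ι → A) (σ : ι → ι) : Prop where
  apply_mul (i j : ι) : φ (e i * e j) = if j = σ i then 1 else 0
  eq_zero (a : A) : (∀ i, φ (a * e i) = 0) → a = 0

namespace IsSelfDualFamily

variable {φ : A →ₗ[k] k} {e : ι → A} {σ : ι → ι} (h : IsSelfDualFamily φ e σ)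

include h

theorem involutive : Function.Involutive σ := fun i => by
  have h1 := h.apply_mul (σ i) i
  rw [mul_comm, h.apply_mul i (σ i), if_pos rfl] at h1
  by_contra hne
  rw [if_neg (Ne.symm hne)] at h1
  exact one_ne_zero h1

variable [Fintype ι]

theorem apply_sum_mul (c : ι → k) (j : ι) : φ ((∑ i, c i • e i) * e j) = c (σ j) := by
  simp only [Finset.sum_mul, map_sum, smul_mul_assoc, map_smul, h.apply_mul, smul_eq_mul,
    mul_ite, mul_one, mul_zero]
  rw [Finset.sum_eq_single (σ j)]
  · rw [h.involutive j, if_pos rfl]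
  · intro i _ hi
    exact if_neg fun hj => hi (by rw [hj, h.involutive i])
  · simp

theorem linearIndependent : LinearIndependent k e := by
  rw [Fintype.linearIndependent_iff]
  intro c hc i
  have := h.apply_sum_mul c (σ i)
  rwa [hc, zero_mul, map_zero, h.involutive i, eq_comm] at this

theorem span_eq_top : ⊤ ≤ Submodule.span k (Set.range e) := by
  intro a _
  have : a = ∑ i, φ (a * e (σ i)) • e i := by
    rw [← sub_eq_zero]
    refine h.eq_zero _ fun j => ?_
    rw [sub_mul, map_sub, h.apply_sum_mul, h.involutive j, sub_self]
  rw [this]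
  exact Submodule.sum_mem _ fun i _ => Submodule.smul_mem _ _ (Submodule.subset_span ⟨i, rfl⟩)

theorem exists_basis : ∃ b : Module.Basis ι k A, ∀ i, b i = e i :=
  ⟨Module.Basis.mk h.linearIndependent h.span_eq_top, fun i => by simp⟩

theorem isArtinianRing : IsArtinianRing A := by
  obtain ⟨b, -⟩ := h.exists_basis
  have : Module.Finite k A := Module.Finite.of_basis b
  exact IsArtinianRing.of_finite k A

/-- The socle has length at most one, as `φ` is injective on it. -/
theorem idealLength_annihilator_le_one [IsLocalRing A]
    (hres : ∀ a : A, ∃ c : k, a - algebraMap k A c ∈ maximalIdeal A) :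
    idealLength (maximalIdeal A).annihilator ≤ 1 := by
  have := h.isArtinianRing
  let f : ↥(maximalIdeal A).annihilator →ₗ[k] k :=
    φ ∘ₗ ((maximalIdeal A).annihilator.subtype.restrictScalars k)
  have hf : Function.Injective f := by
    -- On a socle element a, multiplication by e i is multiplication by its residue in k, so φ a = 0
    -- gives φ (a * e i) = 0 for all i.
    refine (injective_iff_map_eq_zero f).2 fun a ha => Subtype.ext (h.eq_zero _ fun i => ?_)
    obtain ⟨c, hc⟩ := hres (e i)
    have h1 := Submodule.mem_annihilator.1 a.2 _ hc
    have h2 : (a : A) * e i = c • (a : A) := by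
      rw [Algebra.smul_def]
      rw [smul_eq_mul] at h1
      linear_combination h1
    rw [h2, map_smul]
    have : φ a = 0 := ha
    rw [this, smul_zero]
  have h1 := Module.length_le_of_injective f hf
  rw [length_eq_length_of_residue hres, Module.length_eq_one k k, ← coe_idealLength] at h1
  exact_mod_cast h1

theorem isArtinianGorenstein [IsLocalRing A]
    (hres : ∀ a : A, ∃ c : k, a - algebraMap k A c ∈ maximalIdeal A) :
    IsArtinianGorenstein A := by
  have := h.isArtinianRing
  refine ⟨this, inferInstance, ?_⟩
  rw [← coe_idealLength]
  have h1 := h.idealLength_annihilator_le_one hres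
  obtain ⟨z, hz, hmz⟩ := exists_notMem_maximalIdeal_mul_le (bot_ne_top : (⊥ : Ideal A) ≠ ⊤)
  have h2 : (⊥ : Ideal A) < (maximalIdeal A).annihilator := by
    refine bot_lt_iff_ne_bot.2 fun hb => hz ?_
    rw [← hb]
    refine Submodule.mem_annihilator.2 fun a ha => ?_
    have : a * z ∈ (⊥ : Ideal A) :=
      hmz (Ideal.mul_mem_mul ha (Ideal.mem_span_singleton_self z))
    rwa [mul_comm] at this
  have h3 := idealLength_strictMono h2
  exact_mod_cast (by omega : idealLength (maximalIdeal A).annihilator = 1)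

end IsSelfDualFamily

end SelfDual

theorem card_filter_eq_add {ι : Type*} [Fintype ι] {P Q R : ι → Prop} [DecidablePred P]
    [DecidablePred Q] [DecidablePred R] (h : ∀ i, P i ↔ Q i ∨ R i) (hd : ∀ i, ¬ (Q i ∧ R i)) :
    (Finset.univ.filter P).card = (Finset.univ.filter Q).card + (Finset.univ.filter R).card := by
  classical
  rw [← Finset.card_union_of_disjoint
    (Finset.disjoint_filter.2 fun i _ h1 h2 => hd i ⟨h1, h2⟩), ← Finset.filter_or]
  congr 1
  ext i
  simp [h]

variable [IsLocalRing A] [Fintype ι]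

/-! ### Powers of an ideal and their annihilators in an adapted basis -/

section Basis

variable (b : Module.Basis ι k A)
  (hres : ∀ a : A, ∃ c : k, a - algebraMap k A c ∈ maximalIdeal A)

include hres

theorem idealLength_eq_finrank [IsArtinianRing A] [Module.Finite k A] (K : Ideal A) :
    idealLength K = Module.finrank k (K.restrictScalars k) := by
  have h1 := length_eq_length_of_residue hres K
  have h2 : Module.length k K = Module.length k (K.restrictScalars k) := rfl
  rw [h2, Module.length_eq_finrank, ← coe_idealLength] at h1
  exact_mod_cast h1.symm

theorem card_le_idealLength (K : Ideal A) (P : ι → Prop) [DecidablePred P]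
    (h : ∀ i, P i → b i ∈ K) : (Finset.univ.filter P).card ≤ idealLength K := by
  have : Module.Finite k A := Module.Finite.of_basis b
  have : IsArtinianRing A := IsArtinianRing.of_finite k A
  rw [idealLength_eq_finrank hres, ← Fintype.card_subtype]
  have hli : LinearIndependent k fun i : {i // P i} => (⟨b i, h i i.2⟩ : K.restrictScalars k) :=
    LinearIndependent.of_comp (K.restrictScalars k).subtype
      (b.linearIndependent.comp _ Subtype.val_injective)
  exact hli.fintype_card_le_finrank

/-- An ideal spanned by part of the basis, from a count. -/
theorem mem_iff_of_idealLength_le (K : Ideal A) (P : ι → Prop) [DecidablePred P]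
    (h : ∀ i, P i → b i ∈ K) (hle : idealLength K ≤ (Finset.univ.filter P).card) (a : A) :
    a ∈ K ↔ ∀ i, b.repr a i ≠ 0 → P i := by
  have : Module.Finite k A := Module.Finite.of_basis b
  have : IsArtinianRing A := IsArtinianRing.of_finite k A
  have hspan : Submodule.span k (b '' {i | P i}) = K.restrictScalars k := by
    refine Submodule.eq_of_le_of_finrank_le (Submodule.span_le.2 ?_) ?_
    · rintro _ ⟨i, hi, rfl⟩
      exact h i hi
    · rw [← idealLength_eq_finrank hres]
      refine hle.trans (le_of_eq ?_)
      rw [← Fintype.card_subtype, Set.image_eq_range]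
      exact (finrank_span_eq_card (b.linearIndependent.comp (Subtype.val : {i // P i} → ι)
        Subtype.val_injective)).symm
  have : a ∈ K ↔ a ∈ K.restrictScalars k := Iff.rfl
  rw [this, ← hspan, b.mem_span_image]
  exact ⟨fun h i hi => h (Finsupp.mem_support_iff.2 hi),
    fun h i hi => h i (Finsupp.mem_support_iff.1 hi)⟩

theorem idealLength_eq_card_of_mem_iff (K : Ideal A) (P : ι → Prop) [DecidablePred P]
    (h : ∀ a, a ∈ K ↔ ∀ i, b.repr a i ≠ 0 → P i) :
    idealLength K = (Finset.univ.filter P).card := by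
  have : Module.Finite k A := Module.Finite.of_basis b
  have : IsArtinianRing A := IsArtinianRing.of_finite k A
  have hspan : Submodule.span k (b '' {i | P i}) = K.restrictScalars k := by
    ext a
    rw [b.mem_span_image, Submodule.restrictScalars_mem, h]
    exact ⟨fun h i hi => h (Finsupp.mem_support_iff.2 hi),
      fun h i hi => h i (Finsupp.mem_support_iff.1 hi)⟩
  rw [idealLength_eq_finrank hres, ← hspan, ← Fintype.card_subtype, Set.image_eq_range]
  exact finrank_span_eq_card (b.linearIndependent.comp (Subtype.val : {i // P i} → ι)
        Subtype.val_injective)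

variable (hs : idealLength (maximalIdeal A).annihilator ≤ 1) {I : Ideal A} {o l : ι → ℕ}
  (ho : ∀ i, b i ∈ I ^ o i) (hl : ∀ i, b i ∈ (I ^ l i).annihilator)
  (hcount : ∀ n, (Finset.univ.filter fun i => n ≤ o i).card +
    (Finset.univ.filter fun i => l i ≤ n).card = Fintype.card ι)

include hs ho hl hcount

/-- The containments `ho` and `hl` give lower bounds for ℓ(Iⁿ) and ℓ(0 : Iⁿ). By `hcount` these add
up to ℓ(A), which duality makes an upper bound for the sum of the lengths, so both bounds are
attained and both ideals are spanned by parts of the basis. -/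
theorem mem_pow_iff_and_mem_annihilator_pow_iff (n : ℕ) :
    (∀ a, a ∈ I ^ n ↔ ∀ i, b.repr a i ≠ 0 → n ≤ o i) ∧
      (∀ a, a ∈ (I ^ n).annihilator ↔ ∀ i, b.repr a i ≠ 0 → l i ≤ n) := by
  have : Module.Finite k A := Module.Finite.of_basis b
  have : IsArtinianRing A := IsArtinianRing.of_finite k A
  have h1 : ∀ i, n ≤ o i → b i ∈ I ^ n := fun i hi => Ideal.pow_le_pow_right hi (ho i)
  have h2 : ∀ i, l i ≤ n → b i ∈ (I ^ n).annihilator := fun i hi =>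
    Submodule.annihilator_mono (Ideal.pow_le_pow_right hi) (hl i)
  have h3 := card_le_idealLength b hres (I ^ n) _ h1
  have h4 := card_le_idealLength b hres (I ^ n).annihilator _ h2
  have h5 := idealLength_annihilator_add_le hs (I ^ n)
  have h6 : idealLength (⊤ : Ideal A) = Fintype.card ι := by
    rw [idealLength_eq_card_of_mem_iff b hres ⊤ (fun _ => True) (by simp)]
    simp
  have h7 := hcount n
  exact ⟨mem_iff_of_idealLength_le b hres _ _ h1 (by omega),
    mem_iff_of_idealLength_le b hres _ _ h2 (by omega)⟩

theorem length_annihilator_pow_inf_pow (m n : ℕ) :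
    Module.length A ↥((I ^ m).annihilator ⊓ I ^ n) =
      ((Finset.univ.filter fun i => l i ≤ m ∧ n ≤ o i).card : ℕ∞) := by
  have : Module.Finite k A := Module.Finite.of_basis b
  have : IsArtinianRing A := IsArtinianRing.of_finite k A
  have h := mem_pow_iff_and_mem_annihilator_pow_iff b hres hs ho hl hcount
  rw [← coe_idealLength, idealLength_eq_card_of_mem_iff b hres _ (fun i => l i ≤ m ∧ n ≤ o i)]
  intro a
  rw [Submodule.mem_inf, (h m).2, (h n).1]
  exact ⟨fun h i hi => ⟨h.1 i hi, h.2 i hi⟩, fun h => ⟨fun i hi => (h i hi).1,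
    fun i hi => (h i hi).2⟩⟩

theorem hilbertG_eq_card (n : ℕ) :
    hilbertG I n = ((Finset.univ.filter fun i => o i = n).card : ℕ∞) := by
  have : Module.Finite k A := Module.Finite.of_basis b
  have : IsArtinianRing A := IsArtinianRing.of_finite k A
  have h := fun n => idealLength_eq_card_of_mem_iff b hres (I ^ n) _
    (mem_pow_iff_and_mem_annihilator_pow_iff b hres hs ho hl hcount n).1
  have h1 := hilbertG_add_length I n
  rw [← coe_idealLength, ← coe_idealLength, h, h] at h1
  have h2 : (Finset.univ.filter fun i => n ≤ o i).card =
      (Finset.univ.filter fun i => o i = n).card + (Finset.univ.filter fun i => n + 1 ≤ o i).card :=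
    card_filter_eq_add (fun i => by omega) fun i => by omega
  rw [h2, Nat.cast_add] at h1
  exact (ENat.add_left_injective_of_ne_top (ENat.natCast_ne_top _)) h1

theorem length_gradedC_eq_card (u a n : ℕ) : Module.length A (gradedC I u a n) =
    ((Finset.univ.filter fun i => l i ≤ u + 1 - a - n ∧ o i = n).card : ℕ∞) := by
  have h1 := length_gradedC_add I u a n
  rw [length_annihilator_pow_inf_pow b hres hs ho hl hcount,
    length_annihilator_pow_inf_pow b hres hs ho hl hcount] at h1
  have h2 : (Finset.univ.filter fun i => l i ≤ u + 1 - a - n ∧ n ≤ o i).card =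
      (Finset.univ.filter fun i => l i ≤ u + 1 - a - n ∧ o i = n).card +
      (Finset.univ.filter fun i => l i ≤ u + 1 - a - n ∧ n + 1 ≤ o i).card :=
    card_filter_eq_add (fun i => by omega) fun i => by omega
  rw [h2, Nat.cast_add] at h1
  exact (ENat.add_left_injective_of_ne_top (ENat.natCast_ne_top _)) h1

theorem symmDecomp_eq_card (u a n : ℕ) : symmDecomp I u a n =
    ((Finset.univ.filter fun i => u - a - n < l i ∧ l i ≤ u + 1 - a - n ∧ o i = n).card : ℕ∞) := by
  have h1 := symmDecomp_add_length I u a n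
  rw [length_gradedC_eq_card b hres hs ho hl hcount,
    length_gradedC_eq_card b hres hs ho hl hcount] at h1
  have h2 : (Finset.univ.filter fun i => l i ≤ u + 1 - a - n ∧ o i = n).card =
      (Finset.univ.filter fun i =>
        u - a - n < l i ∧ l i ≤ u + 1 - a - n ∧ o i = n).card +
      (Finset.univ.filter fun i => l i ≤ u + 1 - (a + 1) - n ∧ o i = n).card :=
    card_filter_eq_add (fun i => by omega) fun i => by omega
  rw [h2, Nat.cast_add] at h1
  exact (ENat.add_left_injective_of_ne_top (ENat.natCast_ne_top _)) h1

end Basis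

end AdaptedBasis

/-! ### Apolar algebras of sums of monomials -/

section Apolar

variable {k : Type*} [Field k]

/-- The exponent of the monomial `x^a y^b`. -/
noncomputable def expo (α : ℕ × ℕ) : Fin 2 →₀ ℕ := Finsupp.single 0 α.1 + Finsupp.single 1 α.2

theorem expo_zero (α : ℕ × ℕ) : expo α 0 = α.1 := by simp [expo]

theorem expo_one (α : ℕ × ℕ) : expo α 1 = α.2 := by simp [expo]

theorem expo_add (α β : ℕ × ℕ) : expo (α + β) = expo α + expo β := by
  ext i
  fin_cases i
  · simp [expo_zero]
  · simp [expo_one]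

theorem expo_injective : Function.Injective expo := fun α β h => by
  ext
  · rw [← expo_zero, h, expo_zero]
  · rw [← expo_one, h, expo_one]

theorem expo_surjective : Function.Surjective expo := fun γ => ⟨(γ 0, γ 1), by
  ext i
  fin_cases i
  · simp [expo_zero]
  · simp [expo_one]⟩

/-- The coefficient of `Z^[0]` in the contraction of `∑ Z^[f]` by a power series. -/
noncomputable def contractConst (k : Type*) [Field k] (S : List (ℕ × ℕ)) :
    MvPowerSeries (Fin 2) k →ₗ[k] k :=
  (S.map fun f => (MvPowerSeries.coeff (expo f) : MvPowerSeries (Fin 2) k →ₗ[k] k)).sum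

theorem contractConst_cons (f : ℕ × ℕ) (S : List (ℕ × ℕ)) (g : MvPowerSeries (Fin 2) k) :
    contractConst k (f :: S) g = MvPowerSeries.coeff (expo f) g + contractConst k S g := by
  simp [contractConst]

theorem contractConst_monomial (S : List (ℕ × ℕ)) (α : ℕ × ℕ) :
    contractConst k S (MvPowerSeries.monomial (expo α) 1) = (S.count α : k) := by
  classical
  induction S with
  | nil => simp [contractConst]
  | cons f S ih =>
    rw [contractConst_cons, ih, MvPowerSeries.coeff_monomial, List.count_cons, Nat.cast_add,
      add_comm]
    congr 1
    by_cases h : f = α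
    · simp [h]
    · rw [if_neg fun h' => h (expo_injective h')]
      simp [h]

/-- The coefficient of `Z^[γ]` in an element of the divided power ring. -/
noncomputable def dpCoeff (γ : Fin 2 →₀ ℕ) : DPModule k →+ k := Finsupp.applyAddHom γ

theorem dpCoeff_dpMonomial (γ δ : Fin 2 →₀ ℕ) (c : k) [Decidable (δ = γ)] :
    dpCoeff γ (dpMonomial δ c) = if δ = γ then c else 0 :=
  Finsupp.single_apply

theorem monomial_expo_zero :
    (MvPowerSeries.monomial (expo 0) 1 : MvPowerSeries (Fin 2) k) = 1 := by
  have h0 : expo 0 = 0 := by simp [expo]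
  rw [h0, MvPowerSeries.monomial_zero_one]

theorem dpModule_eq_zero_iff (G : DPModule k) : G = 0 ↔ ∀ γ, dpCoeff γ G = 0 :=
  DFunLike.ext_iff (F := (Fin 2 →₀ ℕ) →₀ k)

theorem dpCoeff_smul_dpMonomial (g : MvPowerSeries (Fin 2) k) (β γ : Fin 2 →₀ ℕ) :
    dpCoeff γ (g • dpMonomial β (1 : k)) =
      MvPowerSeries.coeff β (MvPowerSeries.monomial γ 1 * g) := by
  classical
  have h1 : g • dpMonomial β (1 : k) = contract g (dpMonomial β 1) := rfl
  rw [h1, contract_monomial, map_sum, mul_comm, MvPowerSeries.coeff_mul]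
  refine Finset.sum_congr rfl fun p _ => ?_
  rw [dpCoeff_dpMonomial, MvPowerSeries.coeff_monomial]
  split_ifs <;> simp

theorem dpCoeff_smul_dpForm (S : List (ℕ × ℕ)) (g : MvPowerSeries (Fin 2) k) (γ : Fin 2 →₀ ℕ) :
    dpCoeff γ (g • dpForm k S) = contractConst k S (MvPowerSeries.monomial γ 1 * g) := by
  induction S with
  | nil =>
    have : dpForm k [] = 0 := rfl
    rw [this, smul_zero]
    simp [contractConst]
  | cons f S ih =>
    have : dpForm k (f :: S) = dpMonomial (expo f) 1 + dpForm k S := by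
      simp [dpForm, expo]
    rw [this, smul_add, map_add, ih, dpCoeff_smul_dpMonomial, contractConst_cons]

/-- The coefficient of Z^[γ] in g ∘ F is the constant term of (z^γ g) ∘ F. So ann(F) is the largest
ideal in the kernel of `contractConst`, and the induced pairing on A_F is nondegenerate. -/
theorem mem_torsionOf_dpForm_iff (S : List (ℕ × ℕ)) (g : MvPowerSeries (Fin 2) k) :
    g ∈ Ideal.torsionOf (MvPowerSeries (Fin 2) k) (DPModule k) (dpForm k S) ↔
      ∀ γ, contractConst k S (MvPowerSeries.monomial (expo γ) 1 * g) = 0 := by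
  rw [Ideal.mem_torsionOf_iff, dpModule_eq_zero_iff]
  simp only [dpCoeff_smul_dpForm]
  exact expo_surjective.forall

/-- The functional on the apolar algebra induced by `contractConst`. -/
noncomputable def apolarFunctional (k : Type*) [Field k] (S : List (ℕ × ℕ)) :
    ApolarAlgebra (dpForm k S) →ₗ[k] k :=
  ((Ideal.torsionOf (MvPowerSeries (Fin 2) k) (DPModule k) (dpForm k S)).restrictScalars k).liftQ
    (contractConst k S) (fun g hg => by
      have := (mem_torsionOf_dpForm_iff S g).1 hg 0
      rwa [monomial_expo_zero, one_mul] at this) ∘ₗ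
    (Submodule.Quotient.restrictScalarsEquiv k _).symm.toLinearMap

theorem apolarFunctional_mk (S : List (ℕ × ℕ)) (g : MvPowerSeries (Fin 2) k) :
    apolarFunctional k S (Ideal.Quotient.mk _ g) = contractConst k S g := rfl

/-- The class of the monomial `x^a y^b` in the apolar algebra. -/
noncomputable def apolarMonomial (k : Type*) [Field k] (S : List (ℕ × ℕ)) (α : ℕ × ℕ) :
    ApolarAlgebra (dpForm k S) :=
  Ideal.Quotient.mk _ (MvPowerSeries.monomial (expo α) 1)

theorem apolarMonomial_mul (S : List (ℕ × ℕ)) (α β : ℕ × ℕ) :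
    apolarMonomial k S α * apolarMonomial k S β = apolarMonomial k S (α + β) := by
  rw [apolarMonomial, apolarMonomial, ← map_mul, MvPowerSeries.monomial_mul_monomial, ← expo_add,
    one_mul]
  rfl

theorem apolarMonomial_zero (S : List (ℕ × ℕ)) : apolarMonomial k S 0 = 1 := by
  rw [apolarMonomial, monomial_expo_zero, map_one]

theorem apolarMonomial_pow (S : List (ℕ × ℕ)) (α : ℕ × ℕ) (n : ℕ) :
    apolarMonomial k S α ^ n = apolarMonomial k S (n • α) := by
  induction n with
  | zero => rw [pow_zero, zero_smul, apolarMonomial_zero]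
  | succ n ih => rw [pow_succ, ih, apolarMonomial_mul, succ_nsmul]

theorem apolarFunctional_apolarMonomial (S : List (ℕ × ℕ)) (α : ℕ × ℕ) :
    apolarFunctional k S (apolarMonomial k S α) = (S.count α : k) :=
  contractConst_monomial S α

theorem apolar_eq_zero_iff (S : List (ℕ × ℕ)) (a : ApolarAlgebra (dpForm k S)) :
    a = 0 ↔ ∀ γ, apolarFunctional k S (a * apolarMonomial k S γ) = 0 := by
  obtain ⟨g, rfl⟩ := Ideal.Quotient.mk_surjective a
  rw [Ideal.Quotient.eq_zero_iff_mem, mem_torsionOf_dpForm_iff]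
  simp only [apolarMonomial, ← map_mul, apolarFunctional_mk, mul_comm g]

theorem apolarMonomial_eq_of_count {S : List (ℕ × ℕ)} {α β : ℕ × ℕ}
    (h : ∀ γ, S.count (α + γ) = S.count (β + γ)) :
    apolarMonomial k S α = apolarMonomial k S β := by
  rw [← sub_eq_zero, apolar_eq_zero_iff]
  intro γ
  rw [sub_mul, map_sub, apolarMonomial_mul, apolarMonomial_mul, apolarFunctional_apolarMonomial,
    apolarFunctional_apolarMonomial, h, sub_self]

theorem apolarMonomial_eq_zero {S : List (ℕ × ℕ)} {α : ℕ × ℕ} (h : ∀ γ, α + γ ∉ S) :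
    apolarMonomial k S α = 0 := by
  rw [apolar_eq_zero_iff]
  intro γ
  rw [apolarMonomial_mul, apolarFunctional_apolarMonomial, List.count_eq_zero_of_not_mem (h γ),
    Nat.cast_zero]

/-! ### The ideal `(x, y²)` -/

/-- The order of `x^a y^b` with respect to the ideal `(x, y²)`. -/
def monomialOrder (α : ℕ × ℕ) : ℕ := α.1 + α.2 / 2

theorem idealXYsq_eq (S : List (ℕ × ℕ)) : idealXYsq (dpForm k S) =
    Ideal.span {apolarMonomial k S (1, 0), apolarMonomial k S (0, 2)} := by
  have h1 : (MvPowerSeries.X 0 : MvPowerSeries (Fin 2) k) =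
      MvPowerSeries.monomial (expo (1, 0)) 1 := by
    simp [expo, MvPowerSeries.X]
  have h2 : (MvPowerSeries.X 1 ^ 2 : MvPowerSeries (Fin 2) k) =
      MvPowerSeries.monomial (expo (0, 2)) 1 := by
    simp [expo, MvPowerSeries.X_pow_eq]
  rw [idealXYsq, h1, h2]
  rfl

theorem Ideal.mul_mem_pow_add {R : Type*} [CommRing R] {I : Ideal R} {m n : ℕ} {a b : R}
    (ha : a ∈ I ^ m) (hb : b ∈ I ^ n) : a * b ∈ I ^ (m + n) :=
  pow_add I m n ▸ Ideal.mul_mem_mul ha hb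

theorem Ideal.exists_of_mem_span_pair_pow_succ {R : Type*} [CommRing R] {x t a : R} {n : ℕ}
    (ha : a ∈ Ideal.span {x, t} ^ (n + 1)) :
    ∃ c ∈ Ideal.span {x, t} ^ n, ∃ d ∈ Ideal.span {x, t} ^ n, a = c * x + d * t := by
  rw [pow_succ] at ha
  refine Submodule.mul_induction_on ha (fun a ha b hb => ?_) ?_
  · obtain ⟨c, d, rfl⟩ := Ideal.mem_span_pair.1 hb
    exact ⟨a * c, Ideal.mul_mem_right _ _ ha, a * d, Ideal.mul_mem_right _ _ ha, by ring⟩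
  · rintro _ _ ⟨c, hc, d, hd, rfl⟩ ⟨c', hc', d', hd', rfl⟩
    exact ⟨c + c', add_mem hc hc', d + d', add_mem hd hd', by ring⟩

theorem apolarMonomial_mem_pow (S : List (ℕ × ℕ)) (α : ℕ × ℕ) :
    apolarMonomial k S α ∈ idealXYsq (dpForm k S) ^ monomialOrder α := by
  have h1 : apolarMonomial k S (1, 0) ∈ idealXYsq (dpForm k S) := by
    rw [idealXYsq_eq]; exact Ideal.subset_span (by simp)
  have h2 : apolarMonomial k S (0, 2) ∈ idealXYsq (dpForm k S) := by
    rw [idealXYsq_eq]; exact Ideal.subset_span (by simp)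
  have h3 : α = α.1 • (1, 0) + (α.2 / 2) • (0, 2) + (0, α.2 % 2) := by
    ext
    · simp
    · simp; omega
  have h4 : apolarMonomial k S α = apolarMonomial k S (1, 0) ^ α.1 *
      apolarMonomial k S (0, 2) ^ (α.2 / 2) * apolarMonomial k S (0, α.2 % 2) := by
    rw [apolarMonomial_pow, apolarMonomial_pow, apolarMonomial_mul, apolarMonomial_mul, ← h3]
  rw [h4]
  exact Ideal.mul_mem_right _ _ (Ideal.mul_mem_pow_add (Ideal.pow_mem_pow h1 _)
    (Ideal.pow_mem_pow h2 _))

/-- Adding (1, 0) or (0, 2) to an exponent raises its order by exactly one. Hence multiplying z^α by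
either generator of the ideal lowers the bound on the orders of the remaining exponents by one. -/
theorem mul_apolarMonomial_eq_zero {S : List (ℕ × ℕ)} (n : ℕ) :
    ∀ {α : ℕ × ℕ}, (∀ γ, α + γ ∈ S → monomialOrder γ < n) →
      ∀ a ∈ idealXYsq (dpForm k S) ^ n, a * apolarMonomial k S α = 0 := by
  induction n with
  | zero =>
    intro α h a _
    rw [apolarMonomial_eq_zero fun γ hγ => Nat.not_lt_zero _ (h γ hγ), mul_zero]
  | succ n ih =>
    intro α h a ha
    have e := idealXYsq_eq (k := k) S
    obtain ⟨c, hc, d, hd, rfl⟩ := Ideal.exists_of_mem_span_pair_pow_succ (e ▸ ha)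
    have h1 := ih (α := (1, 0) + α) (fun γ hγ => by
      have := h ((1, 0) + γ) (by rwa [← add_assoc, add_comm α])
      simp only [monomialOrder, Prod.fst_add, Prod.snd_add] at this ⊢
      omega) c (e ▸ hc)
    have h2 := ih (α := (0, 2) + α) (fun γ hγ => by
      have := h ((0, 2) + γ) (by rwa [← add_assoc, add_comm α])
      simp only [monomialOrder, Prod.fst_add, Prod.snd_add] at this ⊢
      omega) d (e ▸ hd)
    rw [← apolarMonomial_mul] at h1 h2
    linear_combination h1 + h2

end Apolar

/-! ### Verification of the table -/

section Table

/-- The exponents `f - α` for the `f ≥ α` in `S`, that is, the exponents of the contraction of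
`∑ Z^[f]` by `z^α`. -/
def shifts (S : List (ℕ × ℕ)) (α : ℕ × ℕ) : List (ℕ × ℕ) :=
  (S.filter fun f => α.1 ≤ f.1 ∧ α.2 ≤ f.2).map fun f => (f.1 - α.1, f.2 - α.2)

theorem count_shifts (S : List (ℕ × ℕ)) (α γ : ℕ × ℕ) :
    (shifts S α).count γ = S.count (α + γ) := by
  induction S with
  | nil => rfl
  | cons f S ih =>
    rw [List.count_cons, ← ih]
    by_cases h : α.1 ≤ f.1 ∧ α.2 ≤ f.2
    · have e : shifts (f :: S) α = (f.1 - α.1, f.2 - α.2) :: shifts S α := by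
        simp [shifts, h]
      rw [e, List.count_cons]
      congr 1
      simp only [beq_iff_eq, Prod.ext_iff, Prod.fst_add, Prod.snd_add]
      congr 1
      simp only [eq_iff_iff]
      omega
    · have e : shifts (f :: S) α = shifts S α := by
        simp only [shifts, List.filter_cons, h, decide_false, Bool.false_eq_true, if_false]
      rw [e, if_neg, add_zero]
      simp only [beq_iff_eq, Prod.ext_iff, Prod.fst_add, Prod.snd_add]
      omega

theorem mem_shifts (S : List (ℕ × ℕ)) (α γ : ℕ × ℕ) : γ ∈ shifts S α ↔ α + γ ∈ S := by
  rw [← List.count_pos_iff, count_shifts, List.count_pos_iff]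

/-- The least `n` such that `z^α` kills `(x, y²)ⁿ` in the apolar algebra. -/
def monomialLevel (S : List (ℕ × ℕ)) (α : ℕ × ℕ) : ℕ :=
  ((shifts S α).map fun γ => monomialOrder γ + 1).foldr max 0

theorem monomialOrder_lt_monomialLevel {S : List (ℕ × ℕ)} {α γ : ℕ × ℕ} (h : α + γ ∈ S) :
    monomialOrder γ < monomialLevel S α := by
  rw [← mem_shifts] at h
  unfold monomialLevel
  generalize shifts S α = L at h
  induction L with
  | nil => simp at h
  | cons δ L ih =>
    rw [List.map_cons, List.foldr_cons]
    rcases List.mem_cons.1 h with rfl | h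
    · exact lt_max_of_lt_left (Nat.lt_succ_self _)
    · exact lt_max_of_lt_right (ih h)

/-- The monomials with exponents in `E` are a self-dual family in the apolar algebra of
`∑_{f ∈ S} Z^[f]`: they represent all nonzero monomials, and they are paired by a permutation. -/
def IsDualMonomials (S : List (ℕ × ℕ)) (E : Finset (ℕ × ℕ)) : Prop :=
  (∀ α ∈ E, ∃ β ∈ E, ∀ γ ∈ E, S.count (α + γ) = if γ = β then 1 else 0) ∧
  ∀ f ∈ S, ∀ a ∈ Finset.range (f.1 + 1), ∀ b ∈ Finset.range (f.2 + 1),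
    ∃ β ∈ E, (shifts S (a, b)).Perm (shifts S β)

instance (S : List (ℕ × ℕ)) (E : Finset (ℕ × ℕ)) : Decidable (IsDualMonomials S E) :=
  inferInstanceAs (Decidable (_ ∧ _))

/-- The numerical data of the monomials with exponents in `E` are those of a row of the table. -/
def MatchesRow (E : Finset (ℕ × ℕ)) (row : RealizedSequence) : Prop :=
  (∀ α ∈ E, monomialOrder α + 1 ≤ row.seq.length ∧ monomialLevel row.form α ≤ row.seq.length) ∧
  (∀ n ∈ Finset.range row.seq.length, (E.filter fun α => n ≤ monomialOrder α).card +
    (E.filter fun α => monomialLevel row.form α ≤ n).card = E.card) ∧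
  (∃ α ∈ E, monomialOrder α + 1 = row.seq.length) ∧
  (∀ n ∈ Finset.range row.seq.length,
    (E.filter fun α => monomialOrder α = n).card = row.seq.getD n 0) ∧
  (∀ a ∈ Finset.range row.seq.length, ∀ n ∈ Finset.range row.seq.length,
    (E.filter fun α => row.seq.length - 1 - a - n < monomialLevel row.form α ∧
      monomialLevel row.form α ≤ row.seq.length - 1 + 1 - a - n ∧ monomialOrder α = n).card =
        (row.decomp.getD a []).getD n 0) ∧
  row.decomp.length ≤ row.seq.length ∧ ∀ L ∈ row.decomp, L.length ≤ row.seq.length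

instance (E : Finset (ℕ × ℕ)) (row : RealizedSequence) : Decidable (MatchesRow E row) :=
  inferInstanceAs (Decidable (_ ∧ _))

variable {k : Type*} [Field k]

/-- The functional takes a product of monomials to a count, required to be 0 or 1, so the pairing
has the same form in every characteristic. It detects zero because every monomial is zero in A_F or
equal to one with exponent in E. -/
theorem IsDualMonomials.exists_isSelfDualFamily {S : List (ℕ × ℕ)} {E : Finset (ℕ × ℕ)}
    (h : IsDualMonomials S E) : ∃ σ : E → E,
      IsSelfDualFamily (apolarFunctional k S) (fun α : E => apolarMonomial k S α) σ := by
  obtain ⟨h1, h2⟩ := h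
  choose σ hσ using fun α : E => h1 α α.2
  refine ⟨fun α => ⟨σ α, (hσ α).1⟩, fun α β => ?_, fun a ha => ?_⟩
  · rw [apolarMonomial_mul, apolarFunctional_apolarMonomial, (hσ α).2 β β.2]
    simp only [Subtype.ext_iff]
    split_ifs <;> simp
  · rw [apolar_eq_zero_iff]
    intro γ
    by_cases hγ : ∃ δ, γ + δ ∈ S
    · obtain ⟨δ, hδ⟩ := hγ
      obtain ⟨β, hβ, hperm⟩ := h2 _ hδ γ.1 (by simp) γ.2 (by simp)
      rw [apolarMonomial_eq_of_count (β := β) fun ε => by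
        rw [← count_shifts, ← count_shifts]; exact hperm.count_eq ε]
      exact ha ⟨β, hβ⟩
    · rw [apolarMonomial_eq_zero fun δ hδ => hγ ⟨δ, hδ⟩, mul_zero, map_zero]

open IsLocalRing in
theorem exists_sub_algebraMap_mem_maximalIdeal (J : Ideal (MvPowerSeries (Fin 2) k))
    [IsLocalRing (MvPowerSeries (Fin 2) k ⧸ J)] (a : MvPowerSeries (Fin 2) k ⧸ J) :
    ∃ c : k, a - algebraMap k _ c ∈ maximalIdeal (MvPowerSeries (Fin 2) k ⧸ J) := by
  obtain ⟨g, rfl⟩ := Ideal.Quotient.mk_surjective a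
  refine ⟨MvPowerSeries.constantCoeff g, ?_⟩
  rw [maximalIdeal_quotient_eq_map]
  have : g - MvPowerSeries.C (MvPowerSeries.constantCoeff g) ∈
      maximalIdeal (MvPowerSeries (Fin 2) k) := by
    refine (mem_maximalIdeal _).2 fun hu => ?_
    simpa using MvPowerSeries.isUnit_constantCoeff _ hu
  have h2 := Ideal.mem_map_of_mem (Ideal.Quotient.mk J) this
  rwa [map_sub] at h2

theorem card_filter_coe (E : Finset (ℕ × ℕ)) (P : ℕ × ℕ → Prop) [DecidablePred P] :
    (Finset.univ.filter fun α : E => P α).card = (E.filter P).card := by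
  rw [Finset.card_filter, Finset.card_filter, Finset.sum_coe_sort E fun α => if P α then 1 else 0]

/-- The properties of a row of the table. -/
theorem realizes_of_matchesRow {row : RealizedSequence} {E : Finset (ℕ × ℕ)}
    (hE : IsDualMonomials row.form E) (hrow : MatchesRow E row) :
    IsArtinianGorenstein (ApolarAlgebra (dpForm k row.form)) ∧
      idealXYsq (dpForm k row.form) ^ (row.seq.length - 1) ≠ ⊥ ∧
      idealXYsq (dpForm k row.form) ^ row.seq.length = ⊥ ∧
      (∀ n, hilbertG (idealXYsq (dpForm k row.form)) n = (seqOfList row.seq n : ℕ∞)) ∧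
      (∀ a i, symmDecomp (idealXYsq (dpForm k row.form)) (row.seq.length - 1) a i =
        (seqOfList (row.decomp.getD a []) i : ℕ∞)) := by
  obtain ⟨hlt, hcount, ⟨α₀, hα₀, hlast⟩, hhilb, hsymm, hdec, hdec'⟩ := hrow
  obtain ⟨σ, hσ⟩ := hE.exists_isSelfDualFamily (k := k)
  obtain ⟨b, hb⟩ := hσ.exists_basis
  have : Nontrivial (ApolarAlgebra (dpForm k row.form)) :=
    ⟨b ⟨α₀, hα₀⟩, 0, b.ne_zero _⟩
  have : IsLocalRing (ApolarAlgebra (dpForm k row.form)) :=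
    IsLocalRing.of_surjective' _ Ideal.Quotient.mk_surjective
  have hres := exists_sub_algebraMap_mem_maximalIdeal (k := k)
    (Ideal.torsionOf (MvPowerSeries (Fin 2) k) (DPModule k) (dpForm k row.form))
  have hs := hσ.idealLength_annihilator_le_one hres
  have ho : ∀ α : E, b α ∈ idealXYsq (dpForm k row.form) ^ monomialOrder α := fun α => by
    rw [hb]; exact apolarMonomial_mem_pow _ _
  have hl : ∀ α : E, b α ∈
      (idealXYsq (dpForm k row.form) ^ monomialLevel row.form α).annihilator := fun α => by
    rw [hb]
    refine Submodule.mem_annihilator.2 fun a ha => ?_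
    rw [smul_eq_mul, mul_comm]
    exact mul_apolarMonomial_eq_zero _ (fun γ hγ => monomialOrder_lt_monomialLevel hγ) a ha
  have hc : ∀ n, (Finset.univ.filter fun α : E => n ≤ monomialOrder α).card +
      (Finset.univ.filter fun α : E => monomialLevel row.form α ≤ n).card = Fintype.card E := by
    intro n
    rw [card_filter_coe E fun α => n ≤ monomialOrder α,
      card_filter_coe E fun α => monomialLevel row.form α ≤ n, Fintype.card_coe]
    by_cases hn : n < row.seq.length
    · exact hcount n (Finset.mem_range.2 hn)
    -- Beyond the end degree no order reaches n and every level is at most n.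
    · rw [Finset.filter_false_of_mem fun α hα => by have := hlt α hα; omega,
        Finset.filter_true_of_mem fun α hα => by have := hlt α hα; omega,
        Finset.card_empty, zero_add]
  have hmem := fun n => (mem_pow_iff_and_mem_annihilator_pow_iff b hres hs ho hl hc n).1
  refine ⟨hσ.isArtinianGorenstein hres, fun hbot => ?_, ?_, fun n => ?_, fun a n => ?_⟩
  · refine b.ne_zero ⟨α₀, hα₀⟩ ?_
    have h1 := ho ⟨α₀, hα₀⟩
    rw [(by omega : row.seq.length - 1 = monomialOrder α₀)] at hbot
    exact (Submodule.mem_bot _).1 (hbot ▸ h1)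
  · refine (Submodule.eq_bot_iff _).2 fun a ha => b.repr.map_eq_zero_iff.1 ?_
    ext α
    by_contra hne
    have h1 := (hmem _ a).1 ha α hne
    have h2 := hlt α α.2
    omega
  · rw [hilbertG_eq_card b hres hs ho hl hc, card_filter_coe E fun α => monomialOrder α = n,
      seqOfList]
    by_cases hn : n < row.seq.length
    · rw [hhilb n (Finset.mem_range.2 hn)]
    · rw [Finset.filter_false_of_mem fun α hα => by have := hlt α hα; omega,
        List.getD_eq_default _ _ (by omega), Finset.card_empty]
  · rw [symmDecomp_eq_card b hres hs ho hl hc,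
      card_filter_coe E fun α => row.seq.length - 1 - a - n < monomialLevel row.form α ∧
      monomialLevel row.form α ≤ row.seq.length - 1 + 1 - a - n ∧ monomialOrder α = n, seqOfList]
    by_cases hn : n < row.seq.length
    · by_cases ha : a < row.seq.length
      · rw [hsymm a (Finset.mem_range.2 ha) n (Finset.mem_range.2 hn)]
      -- For a beyond the end degree, truncated subtraction turns both bounds on the level into 0.
      · rw [Finset.filter_false_of_mem fun α hα => by omega,
          List.getD_eq_default row.decomp _ (by omega), Finset.card_empty]
        simp
    · have hlen : (row.decomp.getD a []).length ≤ row.seq.length := by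
        by_cases ha : a < row.decomp.length
        · rw [List.getD_eq_getElem _ _ ha]
          exact hdec' _ (List.getElem_mem ha)
        · rw [List.getD_eq_default row.decomp _ (by omega)]
          simp
      rw [Finset.filter_false_of_mem fun α hα => by have := hlt α hα; omega,
        List.getD_eq_default _ _ (by omega), Finset.card_empty]

/-- Exponents of monomial bases of the apolar algebras of the table. -/
def tableBases : List (List (ℕ × ℕ)) :=
  [[(0, 0), (0, 1), (0, 2)],
   [(0, 0), (0, 1), (1, 0), (1, 1)],
   [(0, 0), (0, 1), (1, 0), (2, 0)],
   [(0, 0), (0, 1), (0, 2), (1, 0), (2, 0)],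
   [(0, 0), (0, 1), (1, 0), (1, 1), (2, 0), (2, 1)],
   [(0, 0), (0, 1), (0, 2), (1, 0), (1, 1), (1, 2)],
   [(0, 0), (0, 1), (0, 2), (0, 4), (1, 0), (1, 1), (2, 0)],
   [(0, 0), (0, 1), (0, 2), (0, 3), (1, 0), (1, 1), (1, 2), (1, 3)],
   [(0, 0), (0, 1), (1, 0), (2, 0), (3, 0)],
   [(0, 0), (0, 1), (0, 2), (1, 0), (2, 0), (3, 0)],
   [(0, 0), (0, 1), (0, 2), (0, 3), (0, 4), (0, 5), (0, 6)],
   [(0, 0), (0, 1), (1, 0), (1, 1), (2, 0), (2, 1), (3, 0), (3, 1)],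
   [(0, 0), (0, 1), (0, 2), (0, 3), (1, 0), (2, 0), (3, 0)],
   [(0, 0), (0, 1), (0, 2), (0, 3), (0, 4), (0, 5), (0, 6), (1, 0)],
   [(0, 0), (0, 1), (0, 2), (0, 3), (0, 4), (0, 5), (0, 6), (0, 7), (1, 0)],
   [(0, 0), (0, 1), (0, 2), (1, 0), (1, 1), (1, 2), (2, 0), (2, 1), (2, 2)],
   [(0, 0), (0, 1), (0, 2), (0, 3), (0, 4), (0, 5), (0, 6), (0, 7), (1, 0), (2, 0)],
   [(0, 0), (0, 1), (0, 2), (0, 3), (0, 4), (0, 5), (0, 6), (1, 0), (1, 1)],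
   [(0, 0), (0, 1), (0, 2), (0, 3), (0, 4), (0, 5), (0, 6), (0, 7), (1, 0), (1, 1)],
   [(0, 0), (0, 1), (0, 2), (0, 3), (0, 4), (1, 0), (1, 1), (1, 2), (1, 3), (1, 4)],
   [(0, 0), (0, 1), (0, 2), (0, 3), (0, 4), (0, 5), (0, 6), (0, 7), (1, 0), (1, 1), (1, 2)],
      [(0, 0), (0, 1), (0, 2), (0, 3), (0, 4), (0, 5), (1, 0), (1, 1), (1, 2), (1, 3), (1, 4), (1,
    5)]]

theorem forall₂_realizedTable_tableBases : List.Forall₂ (fun row L =>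
    IsDualMonomials row.form (List.toFinset L) ∧ MatchesRow (List.toFinset L) row)
      realizedTable tableBases := by
  unfold realizedTable tableBases
  repeat' first
    | exact List.Forall₂.nil
    | refine List.Forall₂.cons (by decide +kernel) ?_

theorem exists_basis_of_mem_realizedTable {row : RealizedSequence} (h : row ∈ realizedTable) :
    ∃ E : Finset (ℕ × ℕ), IsDualMonomials row.form E ∧ MatchesRow E row := by
  obtain ⟨i, hi, rfl⟩ := List.getElem_of_mem h
  have h1 := forall₂_realizedTable_tableBases
  exact ⟨_, h1.get hi (h1.length_eq ▸ hi)⟩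

end Table

/-! ### Admissible sequences -/

section Admissible

/-- The top r terms are C(i, i) = 1 and the others C(i-1, i) = 0. Raising both arguments by one
keeps these values, so r does not grow. -/
theorem isMacaulayRep_of_le {n r : ℕ} (hr : r ≤ n) :
    IsMacaulayRep n r (fun i => if n < i + r then i else i - 1) ∧
      ∑ i ∈ Finset.Icc 1 n, ((if n < i + r then i else i - 1) + 1).choose (i + 1) = r := by
  have hcard : (Finset.filter (fun i => n < i + r) (Finset.Icc 1 n)).card = r := by
    have : Finset.filter (fun i => n < i + r) (Finset.Icc 1 n) = Finset.Ioc (n - r) n := by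
      ext i
      simp only [Finset.mem_filter, Finset.mem_Icc, Finset.mem_Ioc]
      omega
    rw [this, Nat.card_Ioc]
    omega
  refine ⟨⟨fun i hi j hj hij => ?_, ?_⟩, ?_⟩
  · simp only [Set.mem_Icc] at hi hj ⊢
    split_ifs <;> omega
  · conv_lhs => rw [← hcard, Finset.card_filter]
    refine Finset.sum_congr rfl fun i hi => ?_
    have := (Finset.mem_Icc.1 hi).1
    dsimp only
    split_ifs
    · rw [Nat.choose_self]
    · rw [Nat.choose_eq_zero_of_lt (by omega)]
  · conv_rhs => rw [← hcard, Finset.card_filter]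
    refine Finset.sum_congr rfl fun i hi => ?_
    have := (Finset.mem_Icc.1 hi).1
    split_ifs
    · rw [Nat.choose_self]
    · rw [Nat.choose_eq_zero_of_lt (by omega)]

theorem isAdmissible_two_of_le {H : ℕ → ℕ}
    (h : ∀ n, H (n + 1) ≤ (n + 2) * (H n / (n + 1)) + H n % (n + 1)) : IsAdmissible 2 H := by
  intro n
  obtain ⟨h1, h2⟩ := isMacaulayRep_of_le (Nat.lt_succ_iff.1 (Nat.mod_lt (H n) n.succ_pos))
  have e1 : (n + 2 - 1).choose (2 - 1) = n + 1 := Nat.choose_one_right (n + 1)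
  have e2 : (n + 2).choose (2 - 1) = n + 2 := Nat.choose_one_right (n + 2)
  refine ⟨fun i => if n < i + H n % (n + 1) then i else i - 1, ?_, ?_⟩
  · rw [e1]
    exact h1
  · rw [e1, e2]
    exact (h n).trans (le_of_eq (congrArg _ h2.symm))

theorem IsAdmissible.apply_one_le {H : ℕ → ℕ} (h : IsAdmissible 2 H) : H 1 ≤ 2 * H 0 := by
  obtain ⟨κ, -, h1⟩ := h 0
  simpa using h1

theorem IsAdmissible.apply_two_le {H : ℕ → ℕ} (h : IsAdmissible 2 H) :
    H 2 ≤ 3 * (H 1 / 2) + H 1 % 2 := by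
  obtain ⟨κ, ⟨-, hr⟩, h1⟩ := h 1
  norm_num at hr h1
  have hκ : κ 1 < 2 := by omega
  rw [hr]
  refine h1.trans ?_
  interval_cases κ 1 <;> simp

theorem IsAdmissible.apply_three_le {H : ℕ → ℕ} (h : IsAdmissible 2 H) :
    H 3 ≤ 4 * (H 2 / 3) + H 2 % 3 := by
  obtain ⟨κ, ⟨hmono, hr⟩, h1⟩ := h 2
  have h12 : κ 1 < κ 2 := hmono (by simp) (by simp) (by norm_num)
  have hI : Finset.Icc 1 2 = {1, 2} := rfl
  rw [hI, Finset.sum_pair (by norm_num)] at hr h1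
  norm_num at hr h1
  -- The remainder is at most 2 < C(3, 2). Only finitely many pairs remain, so uniqueness of the
  -- Macaulay representation is not needed.
  have hκ : κ 2 < 3 := by
    by_contra! hle
    have := Nat.choose_le_choose 2 hle
    have h3 : Nat.choose 3 2 = 3 := rfl
    omega
  rw [hr]
  refine h1.trans (add_le_add_right ?_ _)
  generalize κ 1 = p at *
  generalize κ 2 = q at *
  clear hr h1
  interval_cases q <;> interval_cases p <;> decide

theorem seqOfList_eq_zero {l : List ℕ} {n : ℕ} (h : l.length ≤ n) : seqOfList l n = 0 :=
  List.getD_eq_default _ _ h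

theorem isAdmissible_of_mem {l : List ℕ}
    (hl : l ∈ realizedSequences ++ excludedSequences ++ furtherExcludedSequences) :
    IsAdmissible 2 (seqOfList l) := by
  have h1 : ∀ l ∈ realizedSequences ++ excludedSequences ++ furtherExcludedSequences,
      l.length ≤ 4 ∧ ∀ n < 4, seqOfList l (n + 1) ≤
        (n + 2) * (seqOfList l n / (n + 1)) + seqOfList l n % (n + 1) := by
    decide
  obtain ⟨h2, h3⟩ := h1 l hl
  refine isAdmissible_two_of_le fun n => ?_
  by_cases hn : n < 4
  · exact h3 n hn
  · rw [seqOfList_eq_zero (by omega)]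
    exact Nat.zero_le _

/-- The growth bounds give H 1 ≤ 4 and then H 2 ≤ 6, and the last entry is 1 or 2, so finitely many
candidates remain. -/
theorem exists_mem_of_isAdmissible {H : ℕ → ℕ} {u : ℕ} (hu : HasEndDegree H u) (h1 : 1 ≤ u)
    (h3 : u ≤ 3) (h0 : H 0 = 2) (hlast : H u ≤ 2) (h : IsAdmissible 2 H) :
    ∃ l ∈ realizedSequences ++ excludedSequences ++ furtherExcludedSequences, H = seqOfList l := by
  have e1 := h.apply_one_le
  have e2 := h.apply_two_le
  have e3 := h.apply_three_le
  obtain ⟨hne, hz⟩ := hu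
  have hH : H = seqOfList ((List.range (u + 1)).map H) := by
    ext n
    by_cases hn : n < u + 1
    · simp [seqOfList, hn]
    · rw [seqOfList_eq_zero (by simpa using hn), hz n (by omega)]
  refine ⟨_, ?_, hH⟩
  rw [h0] at e1
  clear hH hz h
  interval_cases u
  · have e : (List.range (1 + 1)).map H = [H 0, H 1] := rfl
    rw [e, h0]
    generalize H 1 = a at *
    clear e e2
    interval_cases a <;> first | omega | decide
  · have e : (List.range (2 + 1)).map H = [H 0, H 1, H 2] := rfl
    rw [e, h0]
    generalize H 1 = a at *
    generalize H 2 = b at *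
    clear e e3
    interval_cases b <;> interval_cases a <;> first | omega | decide
  · have e : (List.range (3 + 1)).map H = [H 0, H 1, H 2, H 3] := rfl
    rw [e, h0]
    generalize H 1 = a at *
    generalize H 2 = b at *
    generalize H 3 = c at *
    clear e
    interval_cases a <;> interval_cases c <;> first | omega | skip
    all_goals
      have hb : b ≤ 6 := by omega
      interval_cases b <;> first | omega | decide

end Admissible

/-! ### Exclusion, realization and the main theorem -/

theorem not_colengthTwoConditions_of_mem {l : List ℕ}
    (hl : l ∈ excludedSequences ++ furtherExcludedSequences) :
    ¬ ColengthTwoConditions (seqOfList l) := by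
  intro h
  have hz : l.length ≤ 4 → ∀ n, 3 < n → seqOfList l n = 0 := fun hle n hn =>
    seqOfList_eq_zero (by omega)
  simp only [excludedSequences, furtherExcludedSequences, List.cons_append, List.nil_append,
    List.mem_cons, List.not_mem_nil, or_false] at hl
  rcases hl with rfl | rfl | rfl | rfl | rfl | rfl | rfl | rfl | rfl | rfl | rfl
  · exact absurd (h.one_le_three (fun n hn => seqOfList_eq_zero hn) rfl) (by decide)
  · exact absurd (h.two_le_two (by decide)) (by decide)
  · exact absurd (h.two_le_two (by decide)) (by decide)
  · exact absurd (h.two_le_three (by decide)) (by decide)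
  · exact absurd (h.two_le_three (by decide)) (by decide)
  · exact absurd (h.one_le_three_of_last (hz (by decide)) rfl rfl) (by decide)
  · exact absurd (h.two_le_three_of_last (hz (by decide)) rfl) (by decide)
  · exact absurd (h.two_le_three_of_last (hz (by decide)) rfl) (by decide)
  · exact absurd (h.two_add_three_le (hz (by decide))) (by decide)
  · exact absurd (h.two_le_three_of_last (hz (by decide)) rfl) (by decide)
  · exact absurd (h.two_add_three_le (hz (by decide))) (by decide)

theorem not_isIGorenstein_of_mem {k : Type*} [Field k] {l : List ℕ}
    (hl : l ∈ excludedSequences ++ furtherExcludedSequences) : ¬ IsIGorenstein k (seqOfList l) := by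
  intro h
  refine not_colengthTwoConditions_of_mem hl (colengthTwoConditions_of_isIGorenstein h ?_)
  have : ∀ l ∈ excludedSequences ++ furtherExcludedSequences, seqOfList l 0 = 2 := by decide
  exact this l hl

theorem isIGorenstein_of_mem {k : Type*} [Field k] {l : List ℕ} (hl : l ∈ realizedSequences) :
    IsIGorenstein k (seqOfList l) := by
  rw [← realizedTable_map_seq, List.mem_map] at hl
  obtain ⟨row, hrow, rfl⟩ := hl
  obtain ⟨E, h1, h2⟩ := exists_basis_of_mem_realizedTable hrow
  obtain ⟨h3, -, -, h4, -⟩ := realizes_of_matchesRow (k := k) h1 h2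
  exact ⟨_, h3, _, h4⟩

theorem mainTheorem7 (k : Type*) [Field k] :
    -- the 2-admissible sequences with `h₀ = 2`, end degree `1 ≤ u ≤ 3` and `hᵤ ≤ 2`
    (∀ (H : ℕ → ℕ) (u : ℕ), HasEndDegree H u → 1 ≤ u → u ≤ 3 → H 0 = 2 → H u ≤ 2 →
      (IsAdmissible 2 H ↔
        ∃ l ∈ realizedSequences ++ excludedSequences ++ furtherExcludedSequences, H = seqOfList l)) ∧
    -- the I-Gorenstein ones among the 2-admissible sequences with `h₀ = 2` and `1 ≤ u ≤ 3`
    (∀ (H : ℕ → ℕ) (u : ℕ), IsAdmissible 2 H → HasEndDegree H u → 1 ≤ u → u ≤ 3 → H 0 = 2 →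
      (IsIGorenstein k H ↔ ∃ l ∈ realizedSequences, H = seqOfList l)) ∧
    -- each of them is realized by `(x, y²)` in an explicit apolar algebra
    (∀ row ∈ realizedTable,
      IsArtinianGorenstein (ApolarAlgebra (dpForm k row.form)) ∧
      idealXYsq (dpForm k row.form) ^ (row.seq.length - 1) ≠ ⊥ ∧
      idealXYsq (dpForm k row.form) ^ row.seq.length = ⊥ ∧
      (∀ n, hilbertG (idealXYsq (dpForm k row.form)) n = (seqOfList row.seq n : ℕ∞)) ∧
      (∀ a i, symmDecomp (idealXYsq (dpForm k row.form)) (row.seq.length - 1) a i =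
        (seqOfList (row.decomp.getD a []) i : ℕ∞))) ∧
    -- the remaining ones do not occur
    (∀ l ∈ excludedSequences ++ furtherExcludedSequences, ¬ IsIGorenstein k (seqOfList l)) := by
  refine ⟨fun H u hu h1 h3 h0 hlast => ⟨exists_mem_of_isAdmissible hu h1 h3 h0 hlast, ?_⟩,
    fun H u hH hu h1 h3 h0 => ⟨fun h => ?_, ?_⟩, fun row hrow => ?_,
    fun l hl => not_isIGorenstein_of_mem hl⟩
  · rintro ⟨l, hl, rfl⟩
    exact isAdmissible_of_mem hl
  -- The bound on the last entry, needed for the enumeration, is not assumed here; duality supplies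
  -- it.
  · have hlast := (colengthTwoConditions_of_isIGorenstein h h0).last_le hu.2
    obtain ⟨l, hl, rfl⟩ := exists_mem_of_isAdmissible hu h1 h3 h0 hlast hH
    rw [List.append_assoc, List.mem_append] at hl
    exact hl.elim (fun hl => ⟨l, hl, rfl⟩) fun hl => absurd h (not_isIGorenstein_of_mem hl)
  · rintro ⟨l, hl, rfl⟩
    exact isIGorenstein_of_mem hl
  · obtain ⟨E, hE, hE'⟩ := exists_basis_of_mem_realizedTable hrow
    exact realizes_of_matchesRow hE hE'
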